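/- Let $\varphi:\mathbb{R}^n\to\mathbb{R}^n$ be of class $C^1$ and let $K\subset\mathbb{R}^n$ be a nonempty compact set with $\varphi(K)\subset K$. Write $\log$ for the logarithm to base $2$, $B_\delta(a)$ for the open Euclidean ball of radius $\delta$ centred at $a$, and $D\varphi(x)$ for the Jacobian matrix. For an integer $\tau\ge 0$, $a\in K$ and $\delta>0$ let $N(\tau,a,\delta)$ be the minimal number of open $\delta$-balls needed to cover $\varphi^\tau[B_\delta(a)\cap K]$. The limit $$H_{\mathrm{res}}(\varphi,K):=\lim_{\tau\to\infty}\frac1\tau\,\limsup_{\delta\to0+}\,\sup_{a\in K}\log N(\tau,a,\delta)$$ exists; it is called the restoration entropy of the discrete-time system $x(t+1)=\varphi(x(t))$ on $K$. Let $\mathcal{S}^+$ be the set of real symmetric positive definite $n\times n$ matrices. For a continuous map $P:K\to\mathcal{S}^+$ and $x\in K$ let $\alpha_1^P(x|\varphi)\ge\dots\ge\alpha_n^P(x|\varphi)\ge 0$ be the singular values of $D\varphi(x)$ regarded as an operator from $\mathbb{R}^n$ with inner product $\langle P(x)v,w\rangle$ to $\mathbb{R}^n$ with inner product $\langle P(\varphi(x))v,w\rangle$,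 i.e. the square roots of the eigenvalues, counted with multiplicity, of $D\varphi(x)^*D\varphi(x)$, where $D\varphi(x)^*=P(x)^{-1}D\varphi(x)^{\top}P(\varphi(x))$ is the adjoint with respect to these inner products. Put $$\Sigma^P(x|\varphi):=\sum_{i=1}^n\max\{0,\log\alpha_i^P(x|\varphi)\},\qquad \log 0:=-\infty .$$ Then the following hold. (i) For every continuous $P:K\to\mathcal{S}^+$ the maximum of $\Sigma^P(\cdot|\varphi)$ over $K$ is attained and $$H_{\mathrm{res}}(\varphi,K)\le\max_{x\in K}\Sigma^P(x|\varphi).$$ (ii) Suppose in addition that $K$ is the closure of its interior and that $D\varphi(x)$ is invertible for every $x\in K$. Then for every $\varepsilon>0$ there is a continuous $P:K\to\mathcal{S}^+$ with $$H_{\mathrm{res}}(\varphi,K)\ge\max_{x\in K}\Sigma^P(x|\varphi)-\varepsilon .$$ Consequently, under these assumptions, $$H_{\mathrm{res}}(\varphi,K)=\inf_{P}\ \max_{x\in K}\Sigma^P(x|\varphi),$$ the infimum being over all continuous $P:K\to\mathcal{S}^+$. -/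

import Mathlib

open Filter Topology Matrix

noncomputable section

namespace RestorationEntropy

variable {n : ℕ}

/-- The minimal number of open `δ`-balls (with arbitrary centres in `ℝⁿ`) needed to cover `S`.
For `δ > 0` and bounded `S` finite covers exist, see `exists_finite_cover`. -/
def coveringNumber (S : Set (EuclideanSpace ℝ (Fin n))) (δ : ℝ) : ℕ :=
  sInf {k : ℕ | ∃ c : Finset (EuclideanSpace ℝ (Fin n)),
    c.card = k ∧ S ⊆ ⋃ x ∈ c, Metric.ball x δ}

/-- The set whose minimum defines `coveringNumber` is nonempty whenever `S` is bounded. -/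
theorem exists_finite_cover {S : Set (EuclideanSpace ℝ (Fin n))} (hS : Bornology.IsBounded S)
    {δ : ℝ} (hδ : 0 < δ) :
    {k : ℕ | ∃ c : Finset (EuclideanSpace ℝ (Fin n)),
      c.card = k ∧ S ⊆ ⋃ x ∈ c, Metric.ball x δ}.Nonempty := by
  have hT : TotallyBounded S :=
    TotallyBounded.subset subset_closure hS.isCompact_closure.totallyBounded
  obtain ⟨t, ht, hc⟩ := Metric.totallyBounded_iff.1 hT δ hδ
  exact ⟨_, ht.toFinset, rfl, by simpa using hc⟩

/-- `log₂ N(τ, a, δ)`, where `N(τ, a, δ)` is the minimal number of open `δ`-balls needed to cover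
`φ^τ (B_δ(a) ∩ K)`. -/
def logCover (φ : EuclideanSpace ℝ (Fin n) → EuclideanSpace ℝ (Fin n))
    (K : Set (EuclideanSpace ℝ (Fin n))) (τ : ℕ) (a : EuclideanSpace ℝ (Fin n)) (δ : ℝ) : ℝ :=
  Real.logb 2 (coveringNumber (φ^[τ] '' (Metric.ball a δ ∩ K)) δ)

/-- `(1/τ) limsup_{δ → 0+} sup_{a ∈ K} log₂ N(τ, a, δ)`, with values in `[-∞, ∞]`, so that the
supremum and the upper limit are always the true ones. -/
def rate (φ : EuclideanSpace ℝ (Fin n) → EuclideanSpace ℝ (Fin n))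
    (K : Set (EuclideanSpace ℝ (Fin n))) (τ : ℕ) : EReal :=
  (((τ : ℝ)⁻¹ : ℝ) : EReal) *
    limsup (fun δ : ℝ => ⨆ a ∈ K, (logCover φ K τ a δ : EReal)) (𝓝[>] (0 : ℝ))

/-- The restoration entropy: the limit of `rate φ K τ` as `τ → ∞`. -/
def Hres (φ : EuclideanSpace ℝ (Fin n) → EuclideanSpace ℝ (Fin n))
    (K : Set (EuclideanSpace ℝ (Fin n))) : EReal :=
  limUnder atTop (rate φ K)

/-- The Jacobian matrix of `φ` at `x`. -/
def jacobian (φ : EuclideanSpace ℝ (Fin n) → EuclideanSpace ℝ (Fin n))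
    (x : EuclideanSpace ℝ (Fin n)) : Matrix (Fin n) (Fin n) ℝ :=
  Matrix.of fun i j => fderiv ℝ φ x (EuclideanSpace.single j 1) i

/-- `P` restricts to a continuous map from `K` to the symmetric positive definite matrices.
(The values of `P` outside `K` are irrelevant everywhere.) -/
structure IsMetricOn (K : Set (EuclideanSpace ℝ (Fin n)))
    (P : EuclideanSpace ℝ (Fin n) → Matrix (Fin n) (Fin n) ℝ) : Prop where
  continuousOn : ContinuousOn P K
  posDef : ∀ x ∈ K, (P x).PosDef

/-- The adjoint `A*` of `A : (ℝⁿ, ⟨P·,·⟩) → (ℝⁿ, ⟨Q·,·⟩)`, as a matrix; see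
`metricAdjoint_unique`. -/
def metricAdjoint (P Q A : Matrix (Fin n) (Fin n) ℝ) : Matrix (Fin n) (Fin n) ℝ :=
  P⁻¹ * Aᵀ * Q

/-- `metricAdjoint P Q A` is the one and only matrix `B` with
`⟨Q (A v), w⟩ = ⟨P v, B w⟩` for all vectors `v`, `w`. -/
theorem metricAdjoint_unique {P Q : Matrix (Fin n) (Fin n) ℝ} (hP : P.PosDef) (hQ : Q.PosDef)
    (A B : Matrix (Fin n) (Fin n) ℝ) :
    (∀ v w : Fin n → ℝ, (Q *ᵥ (A *ᵥ v)) ⬝ᵥ w = (P *ᵥ v) ⬝ᵥ (B *ᵥ w)) ↔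
      B = metricAdjoint P Q A := by
  have hPt : Pᵀ = P := by simpa using hP.isHermitian.eq
  have hQt : Qᵀ = Q := by simpa using hQ.isHermitian.eq
  have hPd : IsUnit P.det := hP.det_pos.ne'.isUnit
  have h1 : (∀ v w : Fin n → ℝ, (Q *ᵥ (A *ᵥ v)) ⬝ᵥ w = (P *ᵥ v) ⬝ᵥ (B *ᵥ w)) ↔
      Aᵀ * Q = P * B := by
    have hl : ∀ v w : Fin n → ℝ, (Q *ᵥ (A *ᵥ v)) ⬝ᵥ w = v ⬝ᵥ ((Aᵀ * Q) *ᵥ w) := by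
      intro v w
      rw [Matrix.mulVec_mulVec, ← Matrix.vecMul_transpose, ← Matrix.dotProduct_mulVec,
        Matrix.transpose_mul, hQt]
    have hr : ∀ v w : Fin n → ℝ, (P *ᵥ v) ⬝ᵥ (B *ᵥ w) = v ⬝ᵥ ((P * B) *ᵥ w) := by
      intro v w
      rw [← Matrix.vecMul_transpose, ← Matrix.dotProduct_mulVec, Matrix.mulVec_mulVec, hPt]
    constructor
    · intro h
      ext i j
      have := h (Pi.single i 1) (Pi.single j 1)
      rw [hl, hr] at this
      simpa using this
    · intro h v w
      rw [hl, hr, h]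
  rw [h1, metricAdjoint, Matrix.mul_assoc]
  constructor
  · intro h
    rw [h, ← Matrix.mul_assoc, Matrix.nonsing_inv_mul _ hPd, Matrix.one_mul]
  · rintro rfl
    rw [← Matrix.mul_assoc, Matrix.mul_nonsing_inv _ hPd, Matrix.one_mul]

/-- The multiset `{α₁, …, α_n}` of singular values of `A : (ℝⁿ, ⟨P·,·⟩) → (ℝⁿ, ⟨Q·,·⟩)`: the square
roots of the eigenvalues of `A* A`, counted with multiplicity. -/
def metricSingularValues (P Q A : Matrix (Fin n) (Fin n) ℝ) : Multiset ℝ :=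
  ((metricAdjoint P Q A * A).charpoly.roots).map Real.sqrt

open scoped MatrixOrder in
/-- There are exactly `n` singular values (all eigenvalues of `A* A` are real). -/
theorem card_metricSingularValues {P Q : Matrix (Fin n) (Fin n) ℝ} (hP : P.PosDef)
    (hQ : Q.PosDef) (A : Matrix (Fin n) (Fin n) ℝ) :
    Multiset.card (metricSingularValues P Q A) = n := by
  obtain ⟨R, hR⟩ := CStarAlgebra.nonneg_iff_eq_star_mul_self.1 hP.inv.posSemidef.nonneg
  have hH : (R * (Aᵀ * Q * A) * Rᴴ).IsHermitian := by
    apply Matrix.isHermitian_mul_mul_conjTranspose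
    have := Matrix.isHermitian_conjTranspose_mul_mul A hQ.isHermitian
    simpa using this
  have hc : (metricAdjoint P Q A * A).charpoly = (R * (Aᵀ * Q * A) * Rᴴ).charpoly := by
    rw [Matrix.charpoly_mul_comm (R * (Aᵀ * Q * A)) Rᴴ, metricAdjoint, hR]
    simp only [Matrix.star_eq_conjTranspose, Matrix.mul_assoc]
  rw [metricSingularValues, Multiset.card_map, hc, hH.roots_charpoly_eq_eigenvalues]
  simp

/-- `Σ^P(x|φ) = ∑ᵢ max {0, log₂ αᵢ^P(x|φ)}`, where `αᵢ^P(x|φ)` are the singular values of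
`Dφ(x)` as an operator from `(ℝⁿ, ⟨P(x)·,·⟩)` to `(ℝⁿ, ⟨P(φ(x))·,·⟩)`.
A zero singular value contributes `0`, as it does under the convention `log 0 = -∞`. -/
def sigma (φ : EuclideanSpace ℝ (Fin n) → EuclideanSpace ℝ (Fin n))
    (P : EuclideanSpace ℝ (Fin n) → Matrix (Fin n) (Fin n) ℝ)
    (x : EuclideanSpace ℝ (Fin n)) : ℝ :=
  ((metricSingularValues (P x) (P (φ x)) (jacobian φ x)).map
    fun α => max 0 (Real.logb 2 α)).sum

end RestorationEntropy

end

/-!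
The restoration entropy is computed by a volume argument, and an almost optimal metric is built by
iterated geometric means of positive definite matrices.

*The distance.* For `P` positive definite and `H` positive semidefinite let `orderDist P H` be the
sum of the positive parts of `log₂ √λ` over the eigenvalues `λ` of `P⁻¹ H`, so that `Σ^P(x)` is the
distance from `P(x)` to the pull-back of `P` under `φ` at `x`. Everything rests on the formula
`orderDist P H = min {½ log₂ (det X / det P) : X ≥ P, X ≥ H}` in the Loewner order (`orderDist_le`,
`exists_orderDist_eq`), a form of Hadamard's inequality. It yields the triangle inequality along
compositions (`orderDist_mul_le`), the continuity of the distance (`tendsto_orderDist`), and, since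
the geometric mean `#` is monotone and multiplicative for determinants,
`orderDist (M # P) (M # Q) ≤ ½ orderDist P Q` (`orderDist_geomMean_le`).

*Covering numbers.* For small `δ`, the image of a `δ`-ball under `φ^τ` is close to an ellipsoid, and
comparing volumes shows that the number of `δ`-balls needed to cover it is `√(det (1 + Aᵀ A))`,
`A = D(φ^τ)`, up to a factor `4ⁿ`. The upper bound is uniform on `K`
(`eventually_logCover_le`), the lower one holds at interior points (`eventually_le_logCover`) and
passes to `K` by continuity when `K` is the closure of its interior. The upper limits over `δ` are
subadditive in `τ` up to a constant, so the limit exists by Fekete's lemma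
(`exists_tendsto_limsupLogCover_div`).

*Upper bound.* By the triangle inequality the distance from `P` to its pull-back under `φ^τ` is at
most `τ max Σ^P`. On the compact set `K`, replacing `P` by the Euclidean metric changes it by a
bounded amount, which does not matter after division by `τ` (`Hres_le`).

*Almost optimal metric.* For large `k` the Euclidean metric is at distance at most
`2 ^ k (H_res + ε)` from its pull-back under `φ^(2 ^ k)`. If `P` is at distance at most `2r` from its
pull-back under `φ^(2τ)`, then the midpoint `Q = P # (φ^τ)^* P` is at distance at most `r` from its
pull-back under `φ^τ`, because `(φ^τ)^* Q = (φ^τ)^* P # (φ^(2τ))^* P` shares an endpoint with `Q`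
(`exists_isMetricOn_halving`). After `k` halvings one arrives at a metric with
`Σ ≤ H_res + ε` on all of `K`.
-/

noncomputable section

namespace RestorationEntropy

open MeasureTheory
open scoped MatrixOrder

variable {n : ℕ}

/-! ### The Loewner order on real matrices -/

theorem transpose_conj_mono {A B : Matrix (Fin n) (Fin n) ℝ} (h : A ≤ B)
    (C : Matrix (Fin n) (Fin n) ℝ) : Cᵀ * A * C ≤ Cᵀ * B * C := by
  simpa [star_eq_conjTranspose] using star_left_conjugate_le_conjugate h C

theorem transpose_conj_posSemidef {A : Matrix (Fin n) (Fin n) ℝ} (h : A.PosSemidef)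
    (C : Matrix (Fin n) (Fin n) ℝ) : (Cᵀ * A * C).PosSemidef := by
  simpa using h.conjTranspose_mul_mul_same C

theorem transpose_conj_posDef {A C : Matrix (Fin n) (Fin n) ℝ} (h : A.PosDef) (hC : IsUnit C) :
    (Cᵀ * A * C).PosDef := by
  have := (Matrix.IsUnit.posDef_star_left_conjugate_iff (x := A) hC).2 h
  simpa [star_eq_conjTranspose] using this

theorem posDef_of_le {P X : Matrix (Fin n) (Fin n) ℝ} (hP : P.PosDef) (h : P ≤ X) :
    X.PosDef := by
  have := hP.add_posSemidef (Matrix.le_iff.1 h)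
  simpa using this

theorem transpose_eq_of_posDef {P : Matrix (Fin n) (Fin n) ℝ} (hP : P.PosDef) : Pᵀ = P := by
  simpa using hP.isHermitian.eq

theorem exists_transpose_mul_self_of_posSemidef {P : Matrix (Fin n) (Fin n) ℝ} (hP : P.PosSemidef) :
    ∃ R : Matrix (Fin n) (Fin n) ℝ, P = Rᵀ * R := by
  obtain ⟨R, hR⟩ := CStarAlgebra.nonneg_iff_eq_star_mul_self.1 hP.nonneg
  exact ⟨R, by simpa [star_eq_conjTranspose] using hR⟩

theorem exists_transpose_mul_self_of_posDef {P : Matrix (Fin n) (Fin n) ℝ} (hP : P.PosDef) :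
    ∃ R : Matrix (Fin n) (Fin n) ℝ, IsUnit R ∧ P = Rᵀ * R := by
  obtain ⟨R, hR⟩ := exists_transpose_mul_self_of_posSemidef hP.posSemidef
  refine ⟨R, ?_, hR⟩
  have h := hP.det_pos
  rw [hR, det_mul, det_transpose] at h
  rw [Matrix.isUnit_iff_isUnit_det, isUnit_iff_ne_zero]
  rintro h0
  simp [h0] at h

theorem exists_orthogonal_diagonal {H : Matrix (Fin n) (Fin n) ℝ}
    (hH : H.IsHermitian) : ∃ (U : Matrix (Fin n) (Fin n) ℝ) (d : Fin n → ℝ),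
      Uᵀ * U = 1 ∧ H = Uᵀ * diagonal d * U := by
  refine ⟨(star (hH.eigenvectorUnitary : Matrix (Fin n) (Fin n) ℝ)), hH.eigenvalues, ?_, ?_⟩
  · have := Unitary.coe_mul_star_self hH.eigenvectorUnitary
    simpa [star_eq_conjTranspose] using this
  · have := hH.spectral_theorem
    simpa [Unitary.conjStarAlgAut_apply, star_eq_conjTranspose, Function.comp_def] using this

/-- Two quadratic forms, one of them positive definite, are diagonal in a common basis. -/
theorem exists_simultaneous_diagonal {P H : Matrix (Fin n) (Fin n) ℝ} (hP : P.PosDef)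
    (hH : H.IsHermitian) : ∃ (S : Matrix (Fin n) (Fin n) ℝ) (d : Fin n → ℝ),
      IsUnit S ∧ P = Sᵀ * S ∧ H = Sᵀ * diagonal d * S := by
  obtain ⟨R, hR, rfl⟩ := exists_transpose_mul_self_of_posDef hP
  have hRd : IsUnit R.det := (Matrix.isUnit_iff_isUnit_det R).1 hR
  have h1 : R⁻¹ * R = 1 := Matrix.nonsing_inv_mul _ hRd
  have hK : (R⁻¹ᵀ * H * R⁻¹).IsHermitian := by
    simpa using Matrix.isHermitian_conjTranspose_mul_mul R⁻¹ hH
  obtain ⟨U, d, hU, hd⟩ := exists_orthogonal_diagonal hK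
  have hUu : IsUnit U := IsUnit.of_mul_eq_one_right _ hU
  refine ⟨U * R, d, hUu.mul hR, ?_, ?_⟩
  · rw [transpose_mul, Matrix.mul_assoc, ← Matrix.mul_assoc Uᵀ, hU, Matrix.one_mul]
  · calc H = (R⁻¹ * R)ᵀ * H * (R⁻¹ * R) := by simp [h1]
      _ = Rᵀ * (R⁻¹ᵀ * H * R⁻¹) * R := by simp only [transpose_mul, Matrix.mul_assoc]
      _ = _ := by rw [hd]; simp only [transpose_mul, Matrix.mul_assoc]

theorem transpose_conj_le_iff {A B S : Matrix (Fin n) (Fin n) ℝ} (hS : IsUnit S) :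
    Sᵀ * A * S ≤ Sᵀ * B * S ↔ A ≤ B := by
  rw [Matrix.le_iff, Matrix.le_iff, ← Matrix.IsUnit.posSemidef_star_left_conjugate_iff
    (x := B - A) hS]
  simp [star_eq_conjTranspose, Matrix.mul_sub, Matrix.sub_mul]

theorem det_le_one_of_trace_le {M : Matrix (Fin n) (Fin n) ℝ} (hM : M.PosSemidef)
    (h : M.trace ≤ n) : M.det ≤ 1 := by
  rw [hM.isHermitian.trace_eq_sum_eigenvalues] at h
  rw [hM.isHermitian.det_eq_prod_eigenvalues]
  simp only [RCLike.ofReal_real_eq_id, id_eq] at h ⊢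
  -- `x ≤ exp (x - 1)` for each eigenvalue `x`
  calc ∏ i, hM.isHermitian.eigenvalues i
      ≤ ∏ i, Real.exp (hM.isHermitian.eigenvalues i - 1) :=
        Finset.prod_le_prod (fun i _ => hM.eigenvalues_nonneg i)
          fun i _ => by linarith [Real.add_one_le_exp (hM.isHermitian.eigenvalues i - 1)]
    _ ≤ 1 := by
        rw [← Real.exp_sum, Real.exp_le_one_iff, Finset.sum_sub_distrib]
        simpa using h

theorem mul_inv_apply_le_one {X : Matrix (Fin n) (Fin n) ℝ} (hX : X.PosDef) {d : Fin n → ℝ}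
    (hd : ∀ i, 0 ≤ d i) (h : diagonal d ≤ X) (i : Fin n) : d i * X⁻¹ i i ≤ 1 := by
  have hXd : IsUnit X.det := hX.det_pos.ne'.isUnit
  have h1 := transpose_conj_mono h X⁻¹
  have ht : X⁻¹ᵀ = X⁻¹ := transpose_eq_of_posDef hX.inv
  rw [ht, Matrix.nonsing_inv_mul _ hXd, Matrix.one_mul] at h1
  have h2 := (Matrix.le_iff.1 h1).diag_nonneg (i := i)
  have hs : ∀ j, X⁻¹ i j = X⁻¹ j i := fun j => congrFun (congrFun ht j) i
  have h3 : d i * X⁻¹ i i ^ 2 ≤ X⁻¹ i i := by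
    rw [Matrix.sub_apply, sub_nonneg, Matrix.mul_apply] at h2
    refine le_trans ?_ h2
    simp only [Matrix.mul_diagonal]
    calc d i * X⁻¹ i i ^ 2 = X⁻¹ i i * d i * X⁻¹ i i := by ring
      _ ≤ _ := Finset.single_le_sum (f := fun j => X⁻¹ i j * d j * X⁻¹ j i) (fun j _ => by
          rw [← hs j]
          nlinarith [hd j, mul_nonneg (hd j) (sq_nonneg (X⁻¹ i j))]) (Finset.mem_univ i)
  have h4 : 0 < X⁻¹ i i := hX.inv.diag_pos
  by_contra hc
  nlinarith

/-- The determinant of an upper bound of `1` and of a diagonal matrix `d ≥ 0` is at least that of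
their entrywise maximum. This is Hadamard's inequality for `X⁻¹`. -/
theorem prod_max_le_det {X : Matrix (Fin n) (Fin n) ℝ} (h1 : 1 ≤ X) {d : Fin n → ℝ}
    (hd : ∀ i, 0 ≤ d i) (h : diagonal d ≤ X) : ∏ i, max 1 (d i) ≤ X.det := by
  have hX : X.PosDef := posDef_of_le Matrix.PosDef.one h1
  set D : Matrix (Fin n) (Fin n) ℝ := diagonal fun i => √(max 1 (d i)) with hD
  have hm : ∀ i, 0 ≤ max 1 (d i) := fun i => le_max_of_le_left zero_le_one
  have hle : ∀ i, max 1 (d i) * X⁻¹ i i ≤ 1 := by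
    intro i
    rcases max_choice 1 (d i) with h' | h' <;> rw [h']
    · exact mul_inv_apply_le_one hX (d := fun _ => 1) (fun _ => zero_le_one) (by simpa using h1) i
    · exact mul_inv_apply_le_one hX hd h i
  have hps : (Dᵀ * X⁻¹ * D).PosSemidef := transpose_conj_posSemidef hX.inv.posSemidef D
  have htr : (Dᵀ * X⁻¹ * D).trace ≤ n := by
    calc (Dᵀ * X⁻¹ * D).trace = ∑ i, max 1 (d i) * X⁻¹ i i := by
          refine Finset.sum_congr rfl fun i _ => ?_
          simp only [hD, diagonal_transpose, Matrix.diag_apply, Matrix.mul_diagonal,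
            Matrix.diagonal_mul]
          linear_combination X⁻¹ i i * Real.mul_self_sqrt (hm i)
      _ ≤ ∑ _i : Fin n, (1 : ℝ) := Finset.sum_le_sum fun i _ => hle i
      _ = n := by simp
  have hdet := det_le_one_of_trace_le hps htr
  have hDD : D.det * D.det = ∏ i, max 1 (d i) := by
    rw [hD, det_diagonal, ← Finset.prod_mul_distrib]
    exact Finset.prod_congr rfl fun i _ => Real.mul_self_sqrt (hm i)
  rw [det_mul, det_mul, det_transpose, Matrix.det_nonsing_inv, Ring.inverse_eq_inv'] at hdet
  have hXp := hX.det_pos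
  have h5 : (∏ i, max 1 (d i)) / X.det ≤ 1 := by
    rw [← hDD]; calc _ = D.det * X.det⁻¹ * D.det := by ring
      _ ≤ 1 := hdet
  exact (div_le_one hXp).1 h5

theorem det_le_det_of_le {P X : Matrix (Fin n) (Fin n) ℝ} (hP : P.PosDef) (h : P ≤ X) :
    P.det ≤ X.det := by
  obtain ⟨R, hR, rfl⟩ := exists_transpose_mul_self_of_posDef hP
  have hRd : IsUnit R.det := (Matrix.isUnit_iff_isUnit_det R).1 hR
  have h1 : R * R⁻¹ = 1 := Matrix.mul_nonsing_inv _ hRd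
  have h2 := transpose_conj_mono h R⁻¹
  have h3 : R⁻¹ᵀ * (Rᵀ * R) * R⁻¹ = 1 := by
    calc _ = (R * R⁻¹)ᵀ * (R * R⁻¹) := by simp only [transpose_mul, Matrix.mul_assoc]
      _ = 1 := by simp [h1]
  rw [h3] at h2
  have h4 := prod_max_le_det h2 (d := fun _ => 1) (fun _ => zero_le_one) (by simpa using h2)
  simp only [max_self, Finset.prod_const_one, det_mul, det_transpose, Matrix.det_nonsing_inv,
    Ring.inverse_eq_inv'] at h4
  rw [det_mul, det_transpose]
  have h5 : R.det ≠ 0 := hRd.ne_zero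
  have : 0 < R.det * R.det := mul_self_pos.2 h5
  calc R.det * R.det = R.det * R.det * 1 := by ring
    _ ≤ R.det * R.det * ((R.det)⁻¹ * X.det * (R.det)⁻¹) := by gcongr
    _ = X.det := by field_simp

/-! ### The one-sided distance between quadratic forms -/

/-- For `P` positive definite and `H` positive semidefinite, the sum of the positive parts of
`log₂ √λ` over the eigenvalues `λ` of `P⁻¹ H`. On positive definite matrices it
is an asymmetric distance, invariant under congruence; it vanishes exactly when `H ≤ P`. -/
def orderDist (P H : Matrix (Fin n) (Fin n) ℝ) : ℝ :=
  ((P⁻¹ * H).charpoly.roots.map fun l => max 0 (Real.logb 2 (√l))).sum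

theorem sigma_eq_orderDist (φ : EuclideanSpace ℝ (Fin n) → EuclideanSpace ℝ (Fin n))
    (P : EuclideanSpace ℝ (Fin n) → Matrix (Fin n) (Fin n) ℝ) (x : EuclideanSpace ℝ (Fin n)) :
    sigma φ P x = orderDist (P x) ((jacobian φ x)ᵀ * P (φ x) * jacobian φ x) := by
  simp only [sigma, orderDist, metricSingularValues, metricAdjoint, Multiset.map_map,
    Matrix.mul_assoc, Function.comp_def]

theorem max_zero_logb_sqrt {l : ℝ} (hl : 0 ≤ l) :
    max 0 (Real.logb 2 (√l)) = 2⁻¹ * Real.logb 2 (max 1 l) := by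
  have hs : Real.logb 2 (√l) = 2⁻¹ * Real.logb 2 l := by
    rw [Real.logb, Real.log_sqrt hl, Real.logb]; ring
  rcases le_total l 1 with h | h
  · have : Real.logb 2 l ≤ 0 := Real.logb_nonpos one_lt_two hl h
    rw [hs, max_eq_left h, Real.logb_one, max_eq_left (by linarith), mul_zero]
  · have : 0 ≤ Real.logb 2 l := Real.logb_nonneg one_lt_two h
    rw [hs, max_eq_right h, max_eq_right (by linarith)]

theorem orderDist_diagonal {S : Matrix (Fin n) (Fin n) ℝ} (hS : IsUnit S) {d : Fin n → ℝ}
    (hd : ∀ i, 0 ≤ d i) :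
    orderDist (Sᵀ * S) (Sᵀ * diagonal d * S) = 2⁻¹ * Real.logb 2 (∏ i, max 1 (d i)) := by
  have hSd : IsUnit S.det := (Matrix.isUnit_iff_isUnit_det S).1 hS
  have hc : ((Sᵀ * S)⁻¹ * (Sᵀ * diagonal d * S)).charpoly = (diagonal d).charpoly := by
    have : (Sᵀ * S)⁻¹ * (Sᵀ * diagonal d * S) = S⁻¹ * (diagonal d * S) := by
      rw [Matrix.mul_inv_rev]
      calc _ = S⁻¹ * ((Sᵀ⁻¹ * Sᵀ) * (diagonal d * S)) := by simp only [Matrix.mul_assoc]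
        _ = _ := by rw [Matrix.nonsing_inv_mul _ (by simpa using hSd), Matrix.one_mul]
    rw [this, Matrix.charpoly_mul_comm, Matrix.mul_assoc, Matrix.mul_nonsing_inv _ hSd,
      Matrix.mul_one]
  have hr : (diagonal d).charpoly.roots = Finset.univ.val.map d := by
    rw [charpoly_diagonal]
    have := Polynomial.roots_multiset_prod_X_sub_C (Finset.univ.val.map d)
    rwa [Multiset.map_map] at this
  rw [orderDist, hc, hr, Multiset.map_map,
    Real.logb_prod _ _ fun i _ => (lt_max_of_lt_left one_pos).ne', Finset.mul_sum]
  exact Finset.sum_congr rfl fun i _ => max_zero_logb_sqrt (hd i)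

theorem exists_diagonal_nonneg {P H : Matrix (Fin n) (Fin n) ℝ} (hP : P.PosDef)
    (hH : H.PosSemidef) : ∃ (S : Matrix (Fin n) (Fin n) ℝ) (d : Fin n → ℝ),
      IsUnit S ∧ (∀ i, 0 ≤ d i) ∧ P = Sᵀ * S ∧ H = Sᵀ * diagonal d * S := by
  obtain ⟨S, d, hS, rfl, rfl⟩ := exists_simultaneous_diagonal hP hH.isHermitian
  refine ⟨S, d, hS, ?_, rfl, rfl⟩
  have : Sᵀ * 0 * S ≤ Sᵀ * diagonal d * S := by simpa using hH.nonneg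
  rw [transpose_conj_le_iff hS, Matrix.nonneg_iff_posSemidef, posSemidef_diagonal_iff] at this
  exact this

/-- The distance from `P` to `H` bounds from below half the logarithmic growth of volume from `P`
to any common upper bound. -/
theorem orderDist_le {P H X : Matrix (Fin n) (Fin n) ℝ} (hP : P.PosDef) (hH : H.PosSemidef)
    (hPX : P ≤ X) (hHX : H ≤ X) :
    orderDist P H ≤ 2⁻¹ * (Real.logb 2 X.det - Real.logb 2 P.det) := by
  obtain ⟨S, d, hS, hd, rfl, rfl⟩ := exists_diagonal_nonneg hP hH
  have hSd : IsUnit S.det := (Matrix.isUnit_iff_isUnit_det S).1 hS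
  have hXp : 0 < X.det := (posDef_of_le hP hPX).det_pos
  obtain ⟨Y, rfl⟩ : ∃ Y, X = Sᵀ * Y * S := by
    refine ⟨Sᵀ⁻¹ * X * S⁻¹, ?_⟩
    calc X = (Sᵀ * Sᵀ⁻¹) * X * (S⁻¹ * S) := by
          rw [Matrix.mul_nonsing_inv _ (by simpa using hSd), Matrix.nonsing_inv_mul _ hSd]; simp
      _ = _ := by simp only [Matrix.mul_assoc]
  have hY1 : 1 ≤ Y := by
    rw [← transpose_conj_le_iff hS]; simpa using hPX
  rw [transpose_conj_le_iff hS] at hHX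
  rw [orderDist_diagonal hS hd]
  have hs0 : S.det ≠ 0 := hSd.ne_zero
  have hYp : 0 < Y.det := (posDef_of_le Matrix.PosDef.one hY1).det_pos
  have : Real.logb 2 (Sᵀ * Y * S).det - Real.logb 2 (Sᵀ * S).det = Real.logb 2 Y.det := by
    simp only [det_mul, det_transpose]
    rw [← Real.logb_div (by positivity) (by positivity)]
    congr 1
    field_simp
  rw [this]
  have h := prod_max_le_det hY1 hd hHX
  have h0 : 0 < ∏ i, max 1 (d i) := Finset.prod_pos fun i _ => lt_max_of_lt_left one_pos
  have := Real.logb_le_logb_of_le one_lt_two h0 h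
  linarith

/-- The bound `orderDist_le` is attained. -/
theorem exists_orderDist_eq {P H : Matrix (Fin n) (Fin n) ℝ} (hP : P.PosDef)
    (hH : H.PosSemidef) : ∃ X, P ≤ X ∧ H ≤ X ∧
      orderDist P H = 2⁻¹ * (Real.logb 2 X.det - Real.logb 2 P.det) := by
  obtain ⟨S, d, hS, hd, rfl, rfl⟩ := exists_diagonal_nonneg hP hH
  have hSd : IsUnit S.det := (Matrix.isUnit_iff_isUnit_det S).1 hS
  have hs0 : S.det ≠ 0 := hSd.ne_zero
  have h0 : 0 < ∏ i, max 1 (d i) := Finset.prod_pos fun i _ => lt_max_of_lt_left one_pos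
  have hdiag : ∀ {a b : Fin n → ℝ}, (∀ i, a i ≤ b i) → diagonal a ≤ diagonal b := by
    intro a b hab
    rw [Matrix.le_iff, diagonal_sub, posSemidef_diagonal_iff]
    exact fun i => sub_nonneg.2 (hab i)
  refine ⟨Sᵀ * diagonal (fun i => max 1 (d i)) * S, ?_, ?_, ?_⟩
  · have : Sᵀ * 1 * S ≤ Sᵀ * diagonal (fun i => max 1 (d i)) * S := by
      rw [transpose_conj_le_iff hS, ← diagonal_one]
      exact hdiag fun i => le_max_left _ _
    simpa using this
  · rw [transpose_conj_le_iff hS]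
    exact hdiag fun i => le_max_right _ _
  · rw [orderDist_diagonal hS hd]
    simp only [det_mul, det_transpose, det_diagonal]
    rw [← Real.logb_div (by positivity) (by positivity)]
    congr 2
    field_simp

theorem one_add_transpose_mul_self_posDef (A : Matrix (Fin n) (Fin n) ℝ) :
    (1 + Aᵀ * A).PosDef :=
  Matrix.PosDef.one.add_posSemidef (by simpa using Matrix.posSemidef_conjTranspose_mul_self A)

theorem orderDist_one_le (A : Matrix (Fin n) (Fin n) ℝ) :
    orderDist 1 (Aᵀ * A) ≤ 2⁻¹ * Real.logb 2 (1 + Aᵀ * A).det := by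
  have hA : (Aᵀ * A).PosSemidef := by simpa using Matrix.posSemidef_conjTranspose_mul_self A
  have := orderDist_le Matrix.PosDef.one hA (X := 1 + Aᵀ * A)
    (le_add_of_nonneg_right hA.nonneg) (le_add_of_nonneg_left Matrix.PosSemidef.one.nonneg)
  simpa using this

theorem half_logb_det_le (A : Matrix (Fin n) (Fin n) ℝ) :
    2⁻¹ * Real.logb 2 (1 + Aᵀ * A).det ≤ orderDist 1 (Aᵀ * A) + n / 2 := by
  have hA : (Aᵀ * A).PosSemidef := by simpa using Matrix.posSemidef_conjTranspose_mul_self A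
  obtain ⟨X, h1, h2, h3⟩ := exists_orderDist_eq Matrix.PosDef.one hA
  have hle : 1 + Aᵀ * A ≤ (2 : ℝ) • X := by
    rw [two_smul]; exact add_le_add h1 h2
  have hd := det_le_det_of_le (one_add_transpose_mul_self_posDef A) hle
  have hX : 0 < X.det := (posDef_of_le Matrix.PosDef.one h1).det_pos
  have hl := Real.logb_le_logb_of_le one_lt_two (one_add_transpose_mul_self_posDef A).det_pos hd
  rw [det_smul, Real.logb_mul (by positivity) hX.ne', Fintype.card_fin, Real.logb_pow,
    Real.logb_self_eq_one one_lt_two] at hl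
  rw [h3, det_one, Real.logb_one]
  linarith

/-- The matrix inequality `A X⁻¹ Aᵀ ≤ P⁻¹` that expresses `Aᵀ P A ≤ X` on the dual space. -/
theorem mul_inv_mul_transpose_le {P X A : Matrix (Fin n) (Fin n) ℝ} (hP : P.PosDef)
    (hX : X.PosDef) (h : Aᵀ * P * A ≤ X) : A * X⁻¹ * Aᵀ ≤ P⁻¹ := by
  have hXd : IsUnit X.det := hX.det_pos.ne'.isUnit
  have hPd : IsUnit P.det := hP.det_pos.ne'.isUnit
  have hXt : X⁻¹ᵀ = X⁻¹ := transpose_eq_of_posDef hX.inv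
  set Y := A * X⁻¹ * Aᵀ with hY
  have hYt : Yᵀ = Y := by simp only [hY, transpose_mul, transpose_transpose, hXt, Matrix.mul_assoc]
  have h1 : Y * P * Y ≤ Y := by
    have := transpose_conj_mono h (X⁻¹ * Aᵀ)
    have h2 : (X⁻¹ * Aᵀ)ᵀ * X * (X⁻¹ * Aᵀ) = Y := by
      rw [transpose_mul, transpose_transpose, hXt, Matrix.mul_assoc A, Matrix.nonsing_inv_mul _ hXd,
        Matrix.mul_one, hY, Matrix.mul_assoc]
    rw [h2, transpose_mul, transpose_transpose, hXt] at this
    simpa only [hY, Matrix.mul_assoc] using this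
  have h3 : 0 ≤ (P⁻¹ - Y) * P * (P⁻¹ - Y) := by
    have := transpose_conj_posSemidef hP.posSemidef (P⁻¹ - Y)
    rw [transpose_sub, hYt, transpose_eq_of_posDef hP.inv] at this
    exact this.nonneg
  have h4 : (P⁻¹ - Y) * P * (P⁻¹ - Y) = P⁻¹ - Y - Y + Y * P * Y := by
    rw [Matrix.sub_mul, Matrix.nonsing_inv_mul _ hPd, Matrix.sub_mul, Matrix.mul_sub,
      Matrix.mul_sub, Matrix.mul_assoc Y P P⁻¹, Matrix.mul_nonsing_inv _ hPd]
    simp only [Matrix.one_mul, Matrix.mul_one]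
    abel
  rw [h4] at h3
  have h5 : 0 ≤ P⁻¹ - Y - Y + Y := h3.trans (add_le_add_right h1 _)
  rw [sub_add_cancel] at h5
  exact sub_nonneg.1 h5

theorem det_add_transpose_mul_mul {X A R : Matrix (Fin n) (Fin n) ℝ} (hX : IsUnit X.det) :
    (X + Aᵀ * (Rᵀ * R) * A).det = X.det * (1 + R * (A * X⁻¹ * Aᵀ) * Rᵀ).det := by
  have : X + Aᵀ * (Rᵀ * R) * A = X * (1 + (X⁻¹ * Aᵀ * Rᵀ) * (R * A)) := by
    rw [Matrix.mul_add, Matrix.mul_one]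
    congr 1
    calc _ = 1 * (Aᵀ * (Rᵀ * R) * A) := by rw [Matrix.one_mul]
      _ = _ := by rw [← Matrix.mul_nonsing_inv _ hX]; simp only [Matrix.mul_assoc]
  rw [this, det_mul, det_one_add_mul_comm]
  simp only [Matrix.mul_assoc]

/-- The triangle inequality along a composition of linear maps: `∏ max (1, σᵢ)` is
submultiplicative. -/
theorem orderDist_mul_le {P₀ P₁ P₂ : Matrix (Fin n) (Fin n) ℝ} (h₀ : P₀.PosDef) (h₁ : P₁.PosDef)
    (h₂ : P₂.PosDef) (A B : Matrix (Fin n) (Fin n) ℝ) :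
    orderDist P₀ ((B * A)ᵀ * P₂ * (B * A)) ≤
      orderDist P₀ (Aᵀ * P₁ * A) + orderDist P₁ (Bᵀ * P₂ * B) := by
  obtain ⟨X, hX0, hXA, hX⟩ := exists_orderDist_eq h₀ (transpose_conj_posSemidef h₁.posSemidef A)
  obtain ⟨Y, hY1, hYB, hY⟩ := exists_orderDist_eq h₁ (transpose_conj_posSemidef h₂.posSemidef B)
  have hXp := posDef_of_le h₀ hX0
  have hYp := posDef_of_le h₁ hY1
  have hW : (Y - P₁).PosSemidef := Matrix.le_iff.1 hY1
  obtain ⟨R, hR⟩ := exists_transpose_mul_self_of_posSemidef hW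
  -- the common upper bound that realizes the triangle inequality
  set Z := X + Aᵀ * (Y - P₁) * A with hZ
  have hXZ : X ≤ Z := le_add_of_nonneg_right (transpose_conj_posSemidef hW A).nonneg
  have hBZ : (B * A)ᵀ * P₂ * (B * A) ≤ Z := by
    calc (B * A)ᵀ * P₂ * (B * A) = Aᵀ * (Bᵀ * P₂ * B) * A := by
          simp only [transpose_mul, Matrix.mul_assoc]
      _ ≤ Aᵀ * Y * A := transpose_conj_mono hYB A
      _ = Aᵀ * P₁ * A + Aᵀ * (Y - P₁) * A := by
          rw [← Matrix.add_mul, ← Matrix.mul_add]; simp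
      _ ≤ Z := by rw [hZ]; exact add_le_add_left hXA _
  have h := orderDist_le h₀ (transpose_conj_posSemidef h₂.posSemidef (B * A)) (hX0.trans hXZ) hBZ
  have hXd : IsUnit X.det := hXp.det_pos.ne'.isUnit
  have hPd : IsUnit P₁.det := h₁.det_pos.ne'.isUnit
  have hdet : Z.det * P₁.det ≤ X.det * Y.det := by
    have e1 : Z.det = X.det * (1 + R * (A * X⁻¹ * Aᵀ) * Rᵀ).det := by
      rw [hZ, hR, det_add_transpose_mul_mul hXd]
    have e2 : Y.det = P₁.det * (1 + R * P₁⁻¹ * Rᵀ).det := by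
      have : Y = P₁ + (1 : Matrix (Fin n) (Fin n) ℝ)ᵀ * (Rᵀ * R) * 1 := by
        rw [← hR]; simp
      rw [this, det_add_transpose_mul_mul hPd]
      simp
    have e3 : (1 + R * (A * X⁻¹ * Aᵀ) * Rᵀ) ≤ 1 + R * P₁⁻¹ * Rᵀ := by
      have := transpose_conj_mono (mul_inv_mul_transpose_le h₁ hXp hXA) Rᵀ
      rw [transpose_transpose] at this
      exact add_le_add_right this 1
    have e4 : (1 + R * (A * X⁻¹ * Aᵀ) * Rᵀ).PosDef := by
      refine Matrix.PosDef.one.add_posSemidef ?_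
      have := transpose_conj_posSemidef hXp.inv.posSemidef (Aᵀ * Rᵀ)
      simpa only [transpose_mul, transpose_transpose, Matrix.mul_assoc] using this
    have e5 := det_le_det_of_le e4 e3
    have := hXp.det_pos
    have := h₁.det_pos
    rw [e1, e2]
    calc _ = X.det * P₁.det * (1 + R * (A * X⁻¹ * Aᵀ) * Rᵀ).det := by ring
      _ ≤ X.det * P₁.det * (1 + R * P₁⁻¹ * Rᵀ).det := by gcongr
      _ = _ := by ring
  have hZp := (posDef_of_le hXp hXZ).det_pos
  have hl := Real.logb_le_logb_of_le one_lt_two (mul_pos hZp h₁.det_pos) hdet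
  rw [Real.logb_mul hZp.ne' h₁.det_pos.ne', Real.logb_mul hXp.det_pos.ne' hYp.det_pos.ne'] at hl
  rw [hX, hY]
  linarith

/-! ### Topology of the positive definite matrices -/

theorem one_add_posSemidef_of_sum_abs_le {E : Matrix (Fin n) (Fin n) ℝ} (hE : E.IsHermitian)
    (h : ∑ i, ∑ j, |E i j| ≤ 1) : (1 + E).PosSemidef := by
  refine Matrix.PosSemidef.of_dotProduct_mulVec_nonneg (Matrix.isHermitian_one.add hE) fun v => ?_
  have hv : ∀ i j, |v i| * |v j| ≤ v ⬝ᵥ v := by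
    intro i j
    have hs : ∀ k, v k ^ 2 ≤ v ⬝ᵥ v := fun k => by
      rw [pow_two]
      exact Finset.single_le_sum (f := fun k => v k * v k) (fun k _ => mul_self_nonneg _)
        (Finset.mem_univ k)
    nlinarith [hs i, hs j, sq_nonneg (|v i| - |v j|), sq_abs (v i), sq_abs (v j)]
  have hb : |v ⬝ᵥ (E *ᵥ v)| ≤ v ⬝ᵥ v := by
    calc |v ⬝ᵥ (E *ᵥ v)| ≤ ∑ i, ∑ j, |E i j| * (v ⬝ᵥ v) := by
          refine (Finset.abs_sum_le_sum_abs _ _).trans (Finset.sum_le_sum fun i _ => ?_)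
          rw [abs_mul, Matrix.mulVec, dotProduct]
          refine (mul_le_mul_of_nonneg_left (Finset.abs_sum_le_sum_abs _ _) (abs_nonneg _)).trans ?_
          rw [Finset.mul_sum]
          refine Finset.sum_le_sum fun j _ => ?_
          rw [abs_mul]
          calc _ = |E i j| * (|v i| * |v j|) := by ring
            _ ≤ _ := mul_le_mul_of_nonneg_left (hv i j) (abs_nonneg _)
      _ = (∑ i, ∑ j, |E i j|) * (v ⬝ᵥ v) := by simp only [Finset.sum_mul]
      _ ≤ 1 * (v ⬝ᵥ v) := mul_le_mul_of_nonneg_right h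
          (Finset.sum_nonneg fun i _ => mul_self_nonneg _)
      _ = v ⬝ᵥ v := one_mul _
  rw [star_trivial, Matrix.add_mulVec, Matrix.one_mulVec, dotProduct_add]
  linarith [neg_le_of_abs_le hb]

/-- The positive definite matrices are open in the symmetric ones. -/
theorem eventually_nonneg_of_tendsto {α : Type*} {l : Filter α}
    {F : α → Matrix (Fin n) (Fin n) ℝ} {F₀ : Matrix (Fin n) (Fin n) ℝ} (h : Tendsto F l (𝓝 F₀))
    (h₀ : F₀.PosDef) (hF : ∀ᶠ y in l, (F y).IsHermitian) : ∀ᶠ y in l, 0 ≤ F y := by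
  obtain ⟨R, hR, rfl⟩ := exists_transpose_mul_self_of_posDef h₀
  have hRd : IsUnit R.det := (Matrix.isUnit_iff_isUnit_det R).1 hR
  have h1 : R * R⁻¹ = 1 := Matrix.mul_nonsing_inv _ hRd
  have h2 : R⁻¹ * R = 1 := Matrix.nonsing_inv_mul _ hRd
  have hG : Tendsto (fun y => R⁻¹ᵀ * F y * R⁻¹ - 1) l (𝓝 0) := by
    have := ((h.const_mul R⁻¹ᵀ).mul_const R⁻¹).sub_const 1
    have e : R⁻¹ᵀ * (Rᵀ * R) * R⁻¹ = 1 := by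
      calc _ = (R * R⁻¹)ᵀ * (R * R⁻¹) := by simp only [transpose_mul, Matrix.mul_assoc]
        _ = 1 := by simp [h1]
    rwa [e, sub_self] at this
  have hs : Tendsto (fun y => ∑ i, ∑ j, |(R⁻¹ᵀ * F y * R⁻¹ - 1) i j|) l (𝓝 0) := by
    have hc : Continuous fun M : Matrix (Fin n) (Fin n) ℝ => ∑ i, ∑ j, |M i j| := by fun_prop
    have := (hc.tendsto 0).comp hG
    simp only [Matrix.zero_apply, abs_zero, Finset.sum_const_zero] at this
    exact this
  filter_upwards [hs.eventually_le_const one_pos, hF] with y hy hyF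
  have hH : (R⁻¹ᵀ * F y * R⁻¹ - 1).IsHermitian := by
    refine Matrix.IsHermitian.sub ?_ Matrix.isHermitian_one
    simpa using Matrix.isHermitian_conjTranspose_mul_mul R⁻¹ hyF
  have hp := one_add_posSemidef_of_sum_abs_le hH hy
  rw [add_sub_cancel] at hp
  have hq := transpose_conj_posSemidef hp R
  have e : Rᵀ * (R⁻¹ᵀ * F y * R⁻¹) * R = F y := by
    calc _ = (R⁻¹ * R)ᵀ * F y * (R⁻¹ * R) := by simp only [transpose_mul, Matrix.mul_assoc]
      _ = F y := by simp [h2]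
  rw [e] at hq
  exact hq.nonneg

theorem eventually_le_of_tendsto {α : Type*} {l : Filter α}
    {F G : α → Matrix (Fin n) (Fin n) ℝ} {F₀ G₀ : Matrix (Fin n) (Fin n) ℝ}
    (hF : Tendsto F l (𝓝 F₀)) (hG : Tendsto G l (𝓝 G₀)) (h₀ : (G₀ - F₀).PosDef)
    (hFh : ∀ᶠ y in l, (F y).IsHermitian) (hGh : ∀ᶠ y in l, (G y).IsHermitian) :
    ∀ᶠ y in l, F y ≤ G y := by
  have := eventually_nonneg_of_tendsto (hG.sub hF) h₀ (by
    filter_upwards [hFh, hGh] with y h1 h2 using h2.sub h1)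
  filter_upwards [this] with y hy using sub_nonneg.1 hy

theorem eventually_le_smul_of_tendsto {α : Type*} {l : Filter α}
    {F : α → Matrix (Fin n) (Fin n) ℝ} {P : Matrix (Fin n) (Fin n) ℝ}
    (hF : Tendsto F l (𝓝 P)) (hP : P.PosDef) (hFp : ∀ᶠ y in l, (F y).PosDef) {η : ℝ}
    (hη : 0 < η) : ∀ᶠ y in l, F y ≤ (1 + η) • P ∧ P ≤ (1 + η) • F y := by
  have hd : ((1 + η) • P - P).PosDef := by
    rw [add_smul, one_smul, add_sub_cancel_left]; exact hP.smul hη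
  have h1 : 0 < 1 + η := by linarith
  exact (eventually_le_of_tendsto hF tendsto_const_nhds hd (hFp.mono fun y h => h.isHermitian)
    (Eventually.of_forall fun _ => (hP.smul h1).isHermitian)).and
    (eventually_le_of_tendsto tendsto_const_nhds (hF.const_smul (1 + η)) hd
      (Eventually.of_forall fun _ => hP.isHermitian)
      (hFp.mono fun y h => (h.smul h1).isHermitian))

theorem orderDist_le_of_le {P H P' H' : Matrix (Fin n) (Fin n) ℝ} (hP : P.PosDef)
    (hH : H.PosSemidef) (hP' : P'.PosDef) (hH' : H'.PosSemidef) {η : ℝ} (hη : 0 ≤ η)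
    (h1 : P' ≤ (1 + η) • P) (h2 : H' ≤ H + η • P) :
    orderDist P' H' ≤ orderDist P H +
      2⁻¹ * (n * Real.logb 2 (1 + η) + (Real.logb 2 P.det - Real.logb 2 P'.det)) := by
  obtain ⟨X, hPX, hHX, hX⟩ := exists_orderDist_eq hP hH
  have h3 : P' ≤ (1 + η) • X := h1.trans (smul_le_smul_of_nonneg_left hPX (by linarith))
  have h4 : H' ≤ (1 + η) • X := by
    refine h2.trans ?_
    rw [add_smul, one_smul]
    exact add_le_add hHX (smul_le_smul_of_nonneg_left hPX hη)
  have h5 := orderDist_le hP' hH' h3 h4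
  have hXp := (posDef_of_le hP hPX).det_pos
  have h6 : 0 < 1 + η := by linarith
  rw [det_smul, Real.logb_mul (by positivity) hXp.ne', Fintype.card_fin, Real.logb_pow] at h5
  rw [hX]
  linarith

/-- The one-sided distance is continuous, also where its second argument is singular. -/
theorem tendsto_orderDist {α : Type*} {l : Filter α} {F G : α → Matrix (Fin n) (Fin n) ℝ}
    {P H : Matrix (Fin n) (Fin n) ℝ} (hF : Tendsto F l (𝓝 P)) (hG : Tendsto G l (𝓝 H))
    (hP : P.PosDef) (hH : H.PosSemidef) (hFp : ∀ᶠ y in l, (F y).PosDef)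
    (hGp : ∀ᶠ y in l, (G y).PosSemidef) :
    Tendsto (fun y => orderDist (F y) (G y)) l (𝓝 (orderDist P H)) := by
  have hdet : Tendsto (fun y => Real.logb 2 (F y).det) l (𝓝 (Real.logb 2 P.det)) := by
    have hc : Continuous fun M : Matrix (Fin n) (Fin n) ℝ => M.det := by fun_prop
    have := ((hc.tendsto P).comp hF).log hP.det_pos.ne'
    simpa [Real.logb] using this.div_const (Real.log 2)
  rw [Metric.tendsto_nhds]
  intro ε hε
  obtain ⟨η, hη, hηε⟩ : ∃ η : ℝ, 0 < η ∧ n * Real.logb 2 (1 + η) < ε := by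
    have hc : ContinuousAt (fun η : ℝ => n * Real.logb 2 (1 + η)) 0 := by
      have : ContinuousAt (fun η : ℝ => Real.log (1 + η)) 0 :=
        ContinuousAt.log (by fun_prop) (by norm_num)
      simpa [Real.logb] using (this.div_const (Real.log 2)).const_mul (n : ℝ)
    have h0 : ∀ᶠ η in 𝓝[>] (0 : ℝ), n * Real.logb 2 (1 + η) < ε :=
      (hc.tendsto.mono_left nhdsWithin_le_nhds).eventually_lt_const (by simpa using hε)
    obtain ⟨η, h1, h2⟩ := (h0.and self_mem_nhdsWithin).exists
    exact ⟨η, h2, h1⟩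
  have hηP := hP.smul hη
  have hHh : ∀ᶠ y in l, (G y).IsHermitian := hGp.mono fun y h => h.isHermitian
  have e1 : ∀ᶠ y in l, G y ≤ H + η • P :=
    eventually_le_of_tendsto hG tendsto_const_nhds (by simpa using hηP) hHh
      (Eventually.of_forall fun _ => hH.isHermitian.add hηP.isHermitian)
  have e2 : ∀ᶠ y in l, H ≤ G y + η • F y :=
    eventually_le_of_tendsto tendsto_const_nhds (hG.add (hF.const_smul η)) (by simpa using hηP)
      (Eventually.of_forall fun _ => hH.isHermitian)
      (by filter_upwards [hFp, hHh] with y h1 h2 using h2.add (h1.smul hη).isHermitian)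
  have e3 := (Metric.tendsto_nhds.1 hdet) ε hε
  filter_upwards [e1, e2, e3, hFp, hGp, eventually_le_smul_of_tendsto hF hP hFp hη]
    with y h1 h2 h3 h4 h5 h6
  have k1 := orderDist_le_of_le hP hH h4 h5 hη.le h6.1 h1
  have k2 := orderDist_le_of_le h4 h5 hP hH hη.le h6.2 h2
  rw [Real.dist_eq, abs_lt] at h3 ⊢
  constructor <;> linarith [h3.1, h3.2]

/-! ### The geometric mean of two positive definite matrices -/

/-- Squaring reflects the Loewner order when the larger matrix is positive definite. -/
theorem le_of_mul_self_le {Y Z : Matrix (Fin n) (Fin n) ℝ} (hY : Y.IsHermitian) (hZ : Z.PosDef)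
    (h : Y * Y ≤ Z * Z) : Y ≤ Z := by
  have hD : (Z - Y).IsHermitian := hZ.isHermitian.sub hY
  rw [Matrix.le_iff, hD.posSemidef_iff_eigenvalues_nonneg]
  intro i
  by_contra hneg
  simp only [Pi.zero_apply, not_le] at hneg
  set c := hD.eigenvalues i
  set v : Fin n → ℝ := (hD.eigenvectorBasis i).ofLp with hv
  have hv0 : v ≠ 0 := by
    intro h0
    have : hD.eigenvectorBasis i = 0 := by ext j; exact congrFun h0 j
    exact hD.eigenvectorBasis.orthonormal.ne_zero i this
  have hev : (Z - Y) *ᵥ v = c • v := hD.mulVec_eigenvectorBasis i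
  have hYv : Y *ᵥ v = Z *ᵥ v - c • v := by rw [← hev, Matrix.sub_mulVec]; abel
  -- `c < 0` is an eigenvalue of `Z - Y`; then `|Y v| > |Z v|` for an eigenvector `v`
  have hsq : ∀ M : Matrix (Fin n) (Fin n) ℝ, M.IsHermitian →
      v ⬝ᵥ ((M * M) *ᵥ v) = (M *ᵥ v) ⬝ᵥ (M *ᵥ v) := by
    intro M hM
    have hMt : Mᵀ = M := by simpa using hM.eq
    rw [← Matrix.mulVec_mulVec, Matrix.dotProduct_mulVec]
    congr 1
    rw [← Matrix.mulVec_transpose, hMt]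
  have h1 := (Matrix.le_iff.1 h).dotProduct_mulVec_nonneg v
  rw [star_trivial, Matrix.sub_mulVec, dotProduct_sub, hsq _ hY, hsq _ hZ.isHermitian, hYv] at h1
  have h2 := hZ.dotProduct_mulVec_pos hv0
  have h3 : 0 < v ⬝ᵥ v := by
    have := (Matrix.PosDef.one (n := Fin n) (R := ℝ)).dotProduct_mulVec_pos hv0
    simpa using this
  rw [star_trivial] at h2
  simp only [dotProduct_sub, sub_dotProduct, smul_dotProduct, dotProduct_smul, smul_eq_mul,
    dotProduct_comm (Z *ᵥ v) v] at h1
  nlinarith [mul_pos_of_neg_of_neg hneg hneg, mul_pos (neg_pos.2 hneg) h2]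

/-- The geometric mean `P # Q = P^{1/2} (P^{-1/2} Q P^{-1/2})^{1/2} P^{1/2}` of two positive definite
matrices. -/
def geomMean (P Q : Matrix (Fin n) (Fin n) ℝ) : Matrix (Fin n) (Fin n) ℝ :=
  CFC.sqrt P * CFC.sqrt ((CFC.sqrt P)⁻¹ * Q * (CFC.sqrt P)⁻¹) * CFC.sqrt P

theorem sqrt_posDef {P : Matrix (Fin n) (Fin n) ℝ} (hP : P.PosDef) :
    (CFC.sqrt P).PosDef := by
  have h0 : (CFC.sqrt P).PosSemidef := Matrix.nonneg_iff_posSemidef.1 (CFC.sqrt_nonneg P)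
  rw [h0.posDef_iff_det_ne_zero]
  intro hd
  have := hP.det_pos
  rw [← CFC.sqrt_mul_sqrt_self P hP.posSemidef.nonneg, det_mul, hd] at this
  simp at this

theorem geomMean_aux {P Q : Matrix (Fin n) (Fin n) ℝ} (hP : P.PosDef) (hQ : Q.PosDef) :
    (geomMean P Q).PosDef ∧ geomMean P Q * P⁻¹ * geomMean P Q = Q := by
  have hRp := sqrt_posDef hP
  have hRR := CFC.sqrt_mul_sqrt_self P hP.posSemidef.nonneg
  rw [geomMean]
  set R := CFC.sqrt P
  have hRd : IsUnit R.det := hRp.det_pos.ne'.isUnit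
  have hRt : Rᵀ = R := transpose_eq_of_posDef hRp
  have hRit : R⁻¹ᵀ = R⁻¹ := transpose_eq_of_posDef hRp.inv
  have hK : (R⁻¹ * Q * R⁻¹).PosDef := by
    have := transpose_conj_posDef hQ hRp.inv.isUnit
    rwa [hRit] at this
  have hSS := CFC.sqrt_mul_sqrt_self _ hK.posSemidef.nonneg
  have hSp := sqrt_posDef hK
  set S := CFC.sqrt (R⁻¹ * Q * R⁻¹)
  constructor
  · have := transpose_conj_posDef hSp hRp.isUnit
    rwa [hRt] at this
  · have e1 : R * R⁻¹ = 1 := Matrix.mul_nonsing_inv _ hRd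
    have e2 : R⁻¹ * R = 1 := Matrix.nonsing_inv_mul _ hRd
    calc R * S * R * P⁻¹ * (R * S * R) = R * S * (R * R⁻¹) * (R⁻¹ * R) * S * R := by
          rw [← hRR, Matrix.mul_inv_rev]; simp only [Matrix.mul_assoc]
      _ = R * (S * S) * R := by rw [e1, e2]; simp only [Matrix.mul_assoc, Matrix.one_mul]
      _ = (R * R⁻¹) * Q * (R⁻¹ * R) := by rw [hSS]; simp only [Matrix.mul_assoc]
      _ = Q := by rw [e1, e2, Matrix.one_mul, Matrix.mul_one]

theorem geomMean_posDef {P Q : Matrix (Fin n) (Fin n) ℝ} (hP : P.PosDef) (hQ : Q.PosDef) :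
    (geomMean P Q).PosDef := (geomMean_aux hP hQ).1

theorem geomMean_mul_inv_mul {P Q : Matrix (Fin n) (Fin n) ℝ} (hP : P.PosDef) (hQ : Q.PosDef) :
    geomMean P Q * P⁻¹ * geomMean P Q = Q := (geomMean_aux hP hQ).2

theorem le_of_mul_inv_mul_le {P X G : Matrix (Fin n) (Fin n) ℝ} (hP : P.PosDef)
    (hX : X.IsHermitian) (hG : G.PosDef) (h : X * P⁻¹ * X ≤ G * P⁻¹ * G) : X ≤ G := by
  obtain ⟨R, hR, hPR⟩ := exists_transpose_mul_self_of_posDef hP.inv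
  have hRt : IsUnit Rᵀ := (Matrix.isUnit_transpose (A := R)).2 hR
  rw [← transpose_conj_le_iff hRt]
  refine le_of_mul_self_le ?_ (transpose_conj_posDef hG hRt) ?_
  · simpa using Matrix.isHermitian_conjTranspose_mul_mul Rᵀ hX
  · have := transpose_conj_mono h Rᵀ
    rw [hPR] at this
    simpa only [transpose_transpose, Matrix.mul_assoc] using this

/-- The geometric mean is the only positive definite solution of the Riccati equation
`X P⁻¹ X = Q`. -/
theorem eq_geomMean {P Q X : Matrix (Fin n) (Fin n) ℝ} (hP : P.PosDef) (hX : X.PosDef)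
    (hQ : Q.PosDef) (h : X * P⁻¹ * X = Q) : X = geomMean P Q := by
  have hG := geomMean_mul_inv_mul hP hQ
  have hGp := geomMean_posDef hP hQ
  exact le_antisymm (le_of_mul_inv_mul_le hP hX.isHermitian hGp (h.trans hG.symm).le)
    (le_of_mul_inv_mul_le hP hGp.isHermitian hX (hG.trans h.symm).le)

theorem geomMean_comm {P Q : Matrix (Fin n) (Fin n) ℝ} (hP : P.PosDef) (hQ : Q.PosDef) :
    geomMean P Q = geomMean Q P := by
  have hG := geomMean_mul_inv_mul hP hQ
  have hGp := geomMean_posDef hP hQ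
  set G := geomMean P Q
  have hGd : IsUnit G.det := hGp.det_pos.ne'.isUnit
  refine eq_geomMean hQ hGp hP ?_
  rw [← hG, Matrix.mul_inv_rev, Matrix.mul_inv_rev,
    Matrix.nonsing_inv_nonsing_inv _ hP.det_pos.ne'.isUnit]
  calc G * (G⁻¹ * (P * G⁻¹)) * G = (G * G⁻¹) * P * (G⁻¹ * G) := by simp only [Matrix.mul_assoc]
    _ = P := by
      rw [Matrix.mul_nonsing_inv _ hGd, Matrix.nonsing_inv_mul _ hGd, Matrix.one_mul,
        Matrix.mul_one]

theorem geomMean_mono {P Q P' Q' : Matrix (Fin n) (Fin n) ℝ} (hP : P.PosDef) (hQ : Q.PosDef)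
    (hPP : P ≤ P') (hQQ : Q ≤ Q') : geomMean P Q ≤ geomMean P' Q' := by
  have hP' := posDef_of_le hP hPP
  have hQ' := posDef_of_le hQ hQQ
  have hGp := geomMean_posDef hP hQ
  refine le_of_mul_inv_mul_le hP' hGp.isHermitian (geomMean_posDef hP' hQ') ?_
  rw [geomMean_mul_inv_mul hP' hQ']
  refine le_trans ?_ hQQ
  have hinv : P'⁻¹ ≤ P⁻¹ := by
    have := mul_inv_mul_transpose_le hP hP' (A := 1) (by simpa using hPP)
    simpa using this
  have := transpose_conj_mono hinv (geomMean P Q)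
  rwa [transpose_eq_of_posDef hGp, geomMean_mul_inv_mul hP hQ] at this

theorem geomMean_smul {P Q : Matrix (Fin n) (Fin n) ℝ} (hP : P.PosDef) (hQ : Q.PosDef) {c : ℝ}
    (hc : 0 < c) : geomMean (c • P) (c • Q) = c • geomMean P Q := by
  refine (eq_geomMean (hP.smul hc) ((geomMean_posDef hP hQ).smul hc) (hQ.smul hc) ?_).symm
  have : (c • P)⁻¹ = c⁻¹ • P⁻¹ := by
    refine Matrix.inv_eq_right_inv ?_
    rw [Matrix.smul_mul, Matrix.mul_smul, smul_smul, mul_inv_cancel₀ hc.ne', one_smul,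
      Matrix.mul_nonsing_inv _ hP.det_pos.ne'.isUnit]
  rw [this]
  simp only [Matrix.smul_mul, Matrix.mul_smul, smul_smul, geomMean_mul_inv_mul hP hQ]
  congr 1
  field_simp

/-- The geometric mean is equivariant under congruence. -/
theorem transpose_mul_geomMean_mul {P Q C : Matrix (Fin n) (Fin n) ℝ} (hP : P.PosDef)
    (hQ : Q.PosDef) (hC : IsUnit C) :
    Cᵀ * geomMean P Q * C = geomMean (Cᵀ * P * C) (Cᵀ * Q * C) := by
  have hCd : IsUnit C.det := (Matrix.isUnit_iff_isUnit_det C).1 hC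
  refine eq_geomMean (transpose_conj_posDef hP hC)
    (transpose_conj_posDef (geomMean_posDef hP hQ) hC) (transpose_conj_posDef hQ hC) ?_
  rw [Matrix.mul_inv_rev, Matrix.mul_inv_rev]
  set G := geomMean P Q with hG
  calc Cᵀ * G * C * (C⁻¹ * (P⁻¹ * Cᵀ⁻¹)) * (Cᵀ * G * C)
      = Cᵀ * (G * (C * C⁻¹) * P⁻¹ * (Cᵀ⁻¹ * Cᵀ) * G) * C := by simp only [Matrix.mul_assoc]
    _ = Cᵀ * Q * C := by
      rw [Matrix.mul_nonsing_inv _ hCd, Matrix.nonsing_inv_mul _ (by simpa using hCd),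
        Matrix.mul_one, Matrix.mul_one, hG, geomMean_mul_inv_mul hP hQ]

theorem logb_det_geomMean {P Q : Matrix (Fin n) (Fin n) ℝ} (hP : P.PosDef) (hQ : Q.PosDef) :
    Real.logb 2 (geomMean P Q).det = 2⁻¹ * (Real.logb 2 P.det + Real.logb 2 Q.det) := by
  have h := congrArg Matrix.det (geomMean_mul_inv_mul hP hQ)
  have hG := (geomMean_posDef hP hQ).det_pos
  have hPd := hP.det_pos
  rw [det_mul, det_mul, Matrix.det_nonsing_inv, Ring.inverse_eq_inv'] at h
  rw [← h, Real.logb_mul (by positivity) hG.ne', Real.logb_mul hG.ne' (by positivity),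
    Real.logb_inv]
  ring

/-- Taking geometric means with a fixed matrix halves distances at least. A common upper bound `X`
of `P` and `Q` yields the common upper bound `M # X` of `M # P` and `M # Q`. -/
theorem orderDist_geomMean_le {M P Q : Matrix (Fin n) (Fin n) ℝ} (hM : M.PosDef) (hP : P.PosDef)
    (hQ : Q.PosDef) : orderDist (geomMean M P) (geomMean M Q) ≤ 2⁻¹ * orderDist P Q := by
  obtain ⟨X, hPX, hQX, hX⟩ := exists_orderDist_eq hP hQ.posSemidef
  have h := orderDist_le (geomMean_posDef hM hP) (geomMean_posDef hM hQ).posSemidef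
    (geomMean_mono hM hP le_rfl hPX) (geomMean_mono hM hQ le_rfl hQX)
  rw [logb_det_geomMean hM hP, logb_det_geomMean hM (posDef_of_le hP hPX)] at h
  rw [hX]
  linarith

theorem tendsto_of_eventually_le_mul {α : Type*} {l : Filter α} {f : α → ℝ} {c : ℝ} (hc : 0 ≤ c)
    (h : ∀ η : ℝ, 0 < η → ∀ᶠ y in l, f y ≤ (1 + η) * c ∧ c ≤ (1 + η) * f y) :
    Tendsto f l (𝓝 c) := by
  rw [Metric.tendsto_nhds]
  intro ε hε
  have hη : 0 < min 1 (ε / (2 * c + 1)) := by positivity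
  filter_upwards [h _ hη] with y hy
  set η := min 1 (ε / (2 * c + 1)) with hηd
  have h1 : η ≤ 1 := min_le_left _ _
  have h2 : η * (2 * c + 1) ≤ ε := by
    calc _ ≤ ε / (2 * c + 1) * (2 * c + 1) := by gcongr; exact min_le_right _ _
      _ = ε := by field_simp
  rw [Real.dist_eq, abs_lt]
  constructor
  · nlinarith [hy.1, hy.2, mul_nonneg hη.le hc,
      mul_nonneg (mul_nonneg hη.le hc) (sub_nonneg.2 h1), mul_le_mul_of_nonneg_left hy.1 hη.le]
  · nlinarith [hy.1]

/-- Continuity of the geometric mean, deduced from monotonicity and homogeneity. -/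
theorem tendsto_geomMean {α : Type*} {l : Filter α} {F G : α → Matrix (Fin n) (Fin n) ℝ}
    {P Q : Matrix (Fin n) (Fin n) ℝ} (hF : Tendsto F l (𝓝 P)) (hG : Tendsto G l (𝓝 Q))
    (hP : P.PosDef) (hQ : Q.PosDef) (hFp : ∀ᶠ y in l, (F y).PosDef)
    (hGp : ∀ᶠ y in l, (G y).PosDef) :
    Tendsto (fun y => geomMean (F y) (G y)) l (𝓝 (geomMean P Q)) := by
  have hM := geomMean_posDef hP hQ
  have hq : ∀ v : Fin n → ℝ, Tendsto (fun y => v ⬝ᵥ (geomMean (F y) (G y) *ᵥ v)) l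
      (𝓝 (v ⬝ᵥ (geomMean P Q *ᵥ v))) := by
    intro v
    refine tendsto_of_eventually_le_mul ?_ fun η hη => ?_
    · simpa using hM.posSemidef.dotProduct_mulVec_nonneg v
    have h1 : 0 < 1 + η := by linarith
    filter_upwards [hFp, hGp, eventually_le_smul_of_tendsto hF hP hFp hη,
      eventually_le_smul_of_tendsto hG hQ hGp hη] with y h2 h3 h4 h5
    have k1 := geomMean_mono h2 h3 h4.1 h5.1
    have k2 := geomMean_mono hP hQ h4.2 h5.2
    rw [geomMean_smul hP hQ h1] at k1
    rw [geomMean_smul h2 h3 h1] at k2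
    have m1 := (Matrix.le_iff.1 k1).dotProduct_mulVec_nonneg v
    have m2 := (Matrix.le_iff.1 k2).dotProduct_mulVec_nonneg v
    simp only [star_trivial, Matrix.sub_mulVec, dotProduct_sub, Matrix.smul_mulVec,
      dotProduct_smul, smul_eq_mul] at m1 m2
    exact ⟨by linarith, by linarith⟩
  -- polarization
  have hpol : ∀ M : Matrix (Fin n) (Fin n) ℝ, M.PosDef → ∀ i j,
      M i j = 4⁻¹ * ((Pi.single i 1 + Pi.single j 1) ⬝ᵥ (M *ᵥ (Pi.single i 1 + Pi.single j 1)) -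
        (Pi.single i 1 - Pi.single j 1) ⬝ᵥ (M *ᵥ (Pi.single i 1 - Pi.single j 1))) := by
    intro M hM i j
    have hs : M j i = M i j := congrFun (congrFun (transpose_eq_of_posDef hM) i) j
    simp only [Matrix.mulVec_add, Matrix.mulVec_sub, add_dotProduct, sub_dotProduct,
      Matrix.mulVec_single_one, single_dotProduct, Pi.add_apply, Pi.sub_apply, col_apply, one_mul]
    rw [hs]; ring
  refine tendsto_pi_nhds.2 fun i => tendsto_pi_nhds.2 fun j => ?_
  rw [hpol _ hM i j]
  refine (((hq _).sub (hq _)).const_mul _).congr' ?_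
  filter_upwards [hFp, hGp] with y h2 h3
  exact (hpol _ (geomMean_posDef h2 h3) i j).symm

/-! ### Covering numbers and volume -/

theorem coveringNumber_le_card {S : Set (EuclideanSpace ℝ (Fin n))} {δ : ℝ}
    {F : Finset (EuclideanSpace ℝ (Fin n))} (h : S ⊆ ⋃ x ∈ F, Metric.ball x δ) :
    coveringNumber S δ ≤ F.card :=
  Nat.sInf_le ⟨F, rfl, h⟩

theorem exists_card_eq_coveringNumber {S : Set (EuclideanSpace ℝ (Fin n))}
    (hS : Bornology.IsBounded S) {δ : ℝ} (hδ : 0 < δ) :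
    ∃ F : Finset (EuclideanSpace ℝ (Fin n)),
      F.card = coveringNumber S δ ∧ S ⊆ ⋃ x ∈ F, Metric.ball x δ :=
  Nat.sInf_mem (exists_finite_cover hS hδ)

/-- A maximal `δ`-separated subset of `S` yields a cover of `S` by `δ`-balls centred in `S`, whose
cardinality is controlled by the volume of the `δ/2`-neighbourhood of `S`. -/
theorem exists_finset_cover {S T : Set (EuclideanSpace ℝ (Fin n))} {δ : ℝ} (hδ : 0 < δ)
    (hST : ∀ x ∈ S, Metric.ball x (δ / 2) ⊆ T) (hT : volume T ≠ ⊤) :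
    ∃ F : Finset (EuclideanSpace ℝ (Fin n)), ↑F ⊆ S ∧ S ⊆ ⋃ x ∈ F, Metric.ball x δ ∧
      F.card * volume.real (Metric.ball (0 : EuclideanSpace ℝ (Fin n)) (δ / 2)) ≤
        volume.real T := by
  classical
  set b := volume.real (Metric.ball (0 : EuclideanSpace ℝ (Fin n)) (δ / 2)) with hb
  have hb0 : 0 < b := ENNReal.toReal_pos (Metric.measure_ball_pos _ _ (by positivity)).ne'
    measure_ball_lt_top.ne
  let sep : Finset (EuclideanSpace ℝ (Fin n)) → Prop := fun F =>
    ↑F ⊆ S ∧ (F : Set (EuclideanSpace ℝ (Fin n))).Pairwise fun x y => δ ≤ dist x y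
  have hcard : ∀ F, sep F → F.card * b ≤ volume.real T := by
    rintro F ⟨hFS, hF⟩
    have hdisj : (F : Set (EuclideanSpace ℝ (Fin n))).PairwiseDisjoint
        fun x => Metric.ball x (δ / 2) := fun x hx y hy hxy =>
      Metric.ball_disjoint_ball (by linarith [hF hx hy hxy])
    calc F.card * b = ∑ x ∈ F, volume.real (Metric.ball x (δ / 2)) := by
          rw [← nsmul_eq_mul, ← Finset.sum_const]
          refine Finset.sum_congr rfl fun x _ => ?_
          rw [hb, measureReal_def, measureReal_def, Measure.addHaar_ball_center volume x]
      _ = volume.real (⋃ x ∈ F, Metric.ball x (δ / 2)) :=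
          (measureReal_biUnion_finset hdisj fun x _ => measurableSet_ball).symm
      _ ≤ volume.real T := measureReal_mono (Set.iUnion₂_subset fun x hx => hST x (hFS hx)) hT
  have hbdd : BddAbove {k : ℕ | ∃ F, sep F ∧ F.card = k} := by
    refine ⟨⌊volume.real T / b⌋₊, ?_⟩
    rintro k ⟨F, hF, rfl⟩
    exact Nat.le_floor ((le_div_iff₀ hb0).2 (hcard F hF))
  obtain ⟨F, hF, hFk⟩ := Nat.sSup_mem (s := {k : ℕ | ∃ F, sep F ∧ F.card = k})
    ⟨0, ∅, by simp [sep], rfl⟩ hbdd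
  refine ⟨F, hF.1, fun x hx => ?_, hcard F hF⟩
  by_contra hxF
  simp only [Set.mem_iUnion, Metric.mem_ball, not_exists, not_lt] at hxF
  have hxn : x ∉ F := fun h => absurd (hxF x h) (by simpa using hδ)
  have hins : sep (insert x F) := by
    refine ⟨?_, ?_⟩
    · rw [Finset.coe_insert]
      exact Set.insert_subset hx hF.1
    · rw [Finset.coe_insert]
      refine hF.2.insert fun y hy _ => ⟨hxF y hy, ?_⟩
      rw [dist_comm]; exact hxF y hy
  have := le_csSup hbdd ⟨_, hins, rfl⟩
  rw [← hFk, Finset.card_insert_of_notMem hxn] at this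
  omega

theorem volume_real_ball (x : EuclideanSpace ℝ (Fin n)) {r : ℝ} (hr : 0 < r) :
    volume.real (Metric.ball x r) =
      r ^ n * volume.real (Metric.ball (0 : EuclideanSpace ℝ (Fin n)) 1) := by
  rw [measureReal_def, Measure.addHaar_ball_of_pos _ _ hr, ENNReal.toReal_mul,
    ENNReal.toReal_ofReal (by positivity), finrank_euclideanSpace_fin, measureReal_def]

theorem volume_real_ball_one_pos :
    0 < volume.real (Metric.ball (0 : EuclideanSpace ℝ (Fin n)) 1) :=
  ENNReal.toReal_pos (Metric.measure_ball_pos _ _ one_pos).ne' measure_ball_lt_top.ne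

theorem volume_affine_image_ball (M : Matrix (Fin n) (Fin n) ℝ) (p : EuclideanSpace ℝ (Fin n))
    (r : ℝ) : volume ((fun w => -p + w) ⁻¹' (toLpLin 2 2 M '' Metric.ball 0 r)) =
      ENNReal.ofReal |M.det| * volume (Metric.ball (0 : EuclideanSpace ℝ (Fin n)) r) := by
  rw [measure_preimage_add, Measure.addHaar_image_linearMap, LinearMap.det_toLpLin]

/-! ### The ellipsoid attached to a matrix -/

theorem norm_sq_eq_dotProduct (v : EuclideanSpace ℝ (Fin n)) : ‖v‖ ^ 2 = v.ofLp ⬝ᵥ v.ofLp := by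
  rw [EuclideanSpace.real_norm_sq_eq]
  exact Finset.sum_congr rfl fun i _ => pow_two _

theorem exists_mul_transpose_eq (A : Matrix (Fin n) (Fin n) ℝ) :
    ∃ M : Matrix (Fin n) (Fin n) ℝ, IsUnit M ∧ M * Mᵀ = 1 + A * Aᵀ ∧
      Real.logb 2 |M.det| = 2⁻¹ * Real.logb 2 (1 + Aᵀ * A).det := by
  have hp := one_add_transpose_mul_self_posDef Aᵀ
  obtain ⟨R, hR, hPR⟩ := exists_transpose_mul_self_of_posDef hp
  rw [transpose_transpose] at hPR
  refine ⟨Rᵀ, (Matrix.isUnit_transpose (A := R)).2 hR, ?_, ?_⟩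
  · rw [transpose_transpose, hPR]
  · rw [← det_one_add_mul_comm, hPR, det_mul, det_transpose, Real.logb_abs]
    have : R.det ≠ 0 := ((Matrix.isUnit_iff_isUnit_det R).1 hR).ne_zero
    rw [Real.logb_mul this this]
    ring

theorem dotProduct_transpose_mulVec_of_mul_transpose_eq {A M : Matrix (Fin n) (Fin n) ℝ}
    (h : M * Mᵀ = 1 + A * Aᵀ) (v : Fin n → ℝ) :
    (Mᵀ *ᵥ v) ⬝ᵥ (Mᵀ *ᵥ v) = (Aᵀ *ᵥ v) ⬝ᵥ (Aᵀ *ᵥ v) + v ⬝ᵥ v := by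
  rw [Matrix.dotProduct_mulVec (Mᵀ *ᵥ v), Matrix.vecMul_transpose, Matrix.mulVec_mulVec, h,
    Matrix.add_mulVec, add_dotProduct, Matrix.one_mulVec, ← Matrix.mulVec_mulVec,
    Matrix.dotProduct_mulVec (Aᵀ *ᵥ v), Matrix.vecMul_transpose, add_comm]

/-- With `M Mᵀ = 1 + A Aᵀ`, the matrix `M` maps the `r`-ball into the sum of the `r`-ball and its
image under `A`. -/
theorem exists_add_eq_of_mul_transpose_eq {A M : Matrix (Fin n) (Fin n) ℝ} (hM : IsUnit M)
    (h : M * Mᵀ = 1 + A * Aᵀ) (u : EuclideanSpace ℝ (Fin n)) :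
    ∃ y z : EuclideanSpace ℝ (Fin n), toLpLin 2 2 M u = toLpLin 2 2 A y + z ∧
      ‖y‖ ^ 2 + ‖z‖ ^ 2 = ‖u‖ ^ 2 := by
  have hMd : IsUnit Mᵀ.det := by simpa using (Matrix.isUnit_iff_isUnit_det M).1 hM
  obtain ⟨v, hv⟩ : ∃ v, Mᵀ *ᵥ v = u.ofLp :=
    ⟨Mᵀ⁻¹ *ᵥ u.ofLp, by rw [Matrix.mulVec_mulVec, Matrix.mul_nonsing_inv _ hMd, Matrix.one_mulVec]⟩
  refine ⟨WithLp.toLp 2 (Aᵀ *ᵥ v), WithLp.toLp 2 v, ?_, ?_⟩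
  · rw [toLpLin_apply, toLpLin_apply, ← WithLp.toLp_add, ← hv, Matrix.mulVec_mulVec, h,
      Matrix.add_mulVec, Matrix.one_mulVec, Matrix.mulVec_mulVec, add_comm]
  · simp only [norm_sq_eq_dotProduct, ← hv, dotProduct_transpose_mulVec_of_mul_transpose_eq h]

/-- With `M Mᵀ = 1 + A Aᵀ`, every `A y + z` is the image under `M` of a vector of length at most
`√(‖y‖² + ‖z‖²)`. -/
theorem exists_eq_add_of_mul_transpose_eq {A M : Matrix (Fin n) (Fin n) ℝ} (hM : IsUnit M)
    (h : M * Mᵀ = 1 + A * Aᵀ) (y z : EuclideanSpace ℝ (Fin n)) :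
    ∃ u : EuclideanSpace ℝ (Fin n), toLpLin 2 2 M u = toLpLin 2 2 A y + z ∧
      ‖u‖ ^ 2 ≤ ‖y‖ ^ 2 + ‖z‖ ^ 2 := by
  have hMd : IsUnit Mᵀ.det := by simpa using (Matrix.isUnit_iff_isUnit_det M).1 hM
  have hMMd : IsUnit (M * Mᵀ).det := by
    rw [det_mul]; exact (by simpa using hMd : IsUnit M.det).mul hMd
  obtain ⟨v, hv⟩ : ∃ v, (M * Mᵀ) *ᵥ v = A *ᵥ y.ofLp + z.ofLp :=
    ⟨(M * Mᵀ)⁻¹ *ᵥ (A *ᵥ y.ofLp + z.ofLp), by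
      rw [Matrix.mulVec_mulVec, Matrix.mul_nonsing_inv _ hMMd, Matrix.one_mulVec]⟩
  refine ⟨WithLp.toLp 2 (Mᵀ *ᵥ v), ?_, ?_⟩
  · rw [toLpLin_apply, toLpLin_apply, Matrix.mulVec_mulVec, hv, WithLp.toLp_add]
  -- `(Aᵀ v, v)` is the orthogonal projection of `(y, z)` onto the range of `v ↦ (Aᵀ v, v)`
  · simp only [norm_sq_eq_dotProduct]
    have h1 := dotProduct_transpose_mulVec_of_mul_transpose_eq h v
    have h2 : (Mᵀ *ᵥ v) ⬝ᵥ (Mᵀ *ᵥ v) = (Aᵀ *ᵥ v) ⬝ᵥ y.ofLp + v ⬝ᵥ z.ofLp := by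
      calc _ = v ⬝ᵥ ((M * Mᵀ) *ᵥ v) := by
            rw [← Matrix.mulVec_mulVec, Matrix.dotProduct_mulVec v, Matrix.mulVec_transpose]
        _ = _ := by
            rw [hv, dotProduct_add, Matrix.dotProduct_mulVec v, Matrix.mulVec_transpose]
    have h3 : ∀ p q : Fin n → ℝ, 2 * (p ⬝ᵥ q) ≤ p ⬝ᵥ p + q ⬝ᵥ q := by
      intro p q
      have : 0 ≤ (p - q) ⬝ᵥ (p - q) := Finset.sum_nonneg fun i _ => mul_self_nonneg _
      rw [dotProduct_sub, sub_dotProduct, sub_dotProduct, dotProduct_comm q p] at this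
      linarith
    linarith [h3 (Aᵀ *ᵥ v) y.ofLp, h3 v z.ofLp]

theorem logb_two_four_pow (n : ℕ) : Real.logb 2 ((4 : ℝ) ^ n) = 2 * n := by
  rw [Real.logb_pow, show (4 : ℝ) = 2 ^ 2 by norm_num, Real.logb_pow,
    Real.logb_self_eq_one one_lt_two]
  push_cast; ring

/-- If `f` is approximated on a `δ`-ball by an affine map with linear part `A` up to an error `δ`,
the image of the ball is covered by about `√(det (1 + Aᵀ A))` balls of radius `δ`. -/
theorem logb_coveringNumber_le {f : EuclideanSpace ℝ (Fin n) → EuclideanSpace ℝ (Fin n)}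
    {A : Matrix (Fin n) (Fin n) ℝ} {a : EuclideanSpace ℝ (Fin n)} {δ : ℝ} (hδ : 0 < δ)
    (h : ∀ y ∈ Metric.ball a δ, ‖f y - f a - toLpLin 2 2 A (y - a)‖ ≤ δ)
    (K : Set (EuclideanSpace ℝ (Fin n))) :
    Real.logb 2 (coveringNumber (f '' (Metric.ball a δ ∩ K)) δ) ≤
      2⁻¹ * Real.logb 2 (1 + Aᵀ * A).det + 2 * n := by
  obtain ⟨M, hMu, hM, hdet⟩ := exists_mul_transpose_eq A
  have hM0 : 0 < |M.det| := abs_pos.2 ((Matrix.isUnit_iff_isUnit_det M).1 hMu).ne_zero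
  have h0 : 0 ≤ Real.logb 2 |M.det| := by
    have h1 : (1 : Matrix (Fin n) (Fin n) ℝ) ≤ 1 + Aᵀ * A := le_add_of_nonneg_right
      (by simpa using (Matrix.posSemidef_conjTranspose_mul_self A).nonneg)
    have h2 := det_le_det_of_le Matrix.PosDef.one h1
    rw [det_one] at h2
    rw [hdet]
    have := Real.logb_nonneg one_lt_two h2
    positivity
  rw [← hdet]
  -- all `δ/2`-balls centred in the image lie in a translate `T` of the ellipsoid `M (B_{2δ})`
  set N := coveringNumber (f '' (Metric.ball a δ ∩ K)) δ
  rcases Nat.eq_zero_or_pos N with hN | hN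
  · rw [hN, Nat.cast_zero, Real.logb_zero]; positivity
  set T := (fun w => -f a + w) ⁻¹' (toLpLin 2 2 M '' Metric.ball 0 (2 * δ)) with hTdef
  have hTv : volume T = ENNReal.ofReal |M.det| *
      volume (Metric.ball (0 : EuclideanSpace ℝ (Fin n)) (2 * δ)) := volume_affine_image_ball M _ _
  have hST : ∀ x ∈ f '' (Metric.ball a δ ∩ K), Metric.ball x (δ / 2) ⊆ T := by
    rintro _ ⟨y, ⟨hy, -⟩, rfl⟩ w hw
    set z := (f y - f a - toLpLin 2 2 A (y - a)) + (w - f y) with hz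
    obtain ⟨u, hu, hun⟩ := exists_eq_add_of_mul_transpose_eq hMu hM (y - a) z
    have hzn : ‖z‖ ≤ 3 / 2 * δ := by
      have h3 := norm_add_le (f y - f a - toLpLin 2 2 A (y - a)) (w - f y)
      rw [Metric.mem_ball, dist_eq_norm] at hw
      linarith [h y hy]
    have hyn : ‖y - a‖ < δ := by rwa [Metric.mem_ball, dist_eq_norm] at hy
    refine ⟨u, ?_, ?_⟩
    · rw [mem_ball_zero_iff]
      refine lt_of_pow_lt_pow_left₀ 2 (by positivity) ?_
      nlinarith [norm_nonneg z, norm_nonneg (y - a)]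
    · change toLpLin 2 2 M u = -f a + w
      rw [hu, hz]; abel
  obtain ⟨F, -, hFc, hF⟩ := exists_finset_cover hδ hST (by
    rw [hTv]; exact ENNReal.mul_ne_top ENNReal.ofReal_ne_top measure_ball_lt_top.ne)
  have hv := volume_real_ball_one_pos (n := n)
  rw [measureReal_def volume T, hTv, ENNReal.toReal_mul, ENNReal.toReal_ofReal (abs_nonneg _),
    ← measureReal_def, volume_real_ball _ (half_pos hδ),
    volume_real_ball _ (r := 2 * δ) (by positivity)] at hF
  have hNF : (N : ℝ) ≤ F.card := by exact_mod_cast coveringNumber_le_card hFc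
  have h4 : (N : ℝ) ≤ |M.det| * 4 ^ n := by
    have e : (2 * δ) ^ n = 4 ^ n * (δ / 2) ^ n := by rw [← mul_pow]; ring
    rw [e] at hF
    have h5 : 0 < (δ / 2) ^ n * volume.real (Metric.ball (0 : EuclideanSpace ℝ (Fin n)) 1) := by
      positivity
    refine le_of_mul_le_mul_right ?_ h5
    calc _ ≤ (F.card : ℝ) * ((δ / 2) ^ n * _) := by gcongr
      _ ≤ _ := hF
      _ = _ := by ring
  have hN' : (0 : ℝ) < N := by exact_mod_cast hN
  have h6 := Real.logb_le_logb_of_le one_lt_two hN' h4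
  rw [Real.logb_mul hM0.ne' (by positivity), logb_two_four_pow] at h6
  exact h6

/-- The lower bound that matches `logb_coveringNumber_le`. -/
theorem le_logb_coveringNumber {f : EuclideanSpace ℝ (Fin n) → EuclideanSpace ℝ (Fin n)}
    {A : Matrix (Fin n) (Fin n) ℝ} {a : EuclideanSpace ℝ (Fin n)} {δ : ℝ} (hδ : 0 < δ)
    (h : ∀ y ∈ Metric.ball a δ, ‖f y - f a - toLpLin 2 2 A (y - a)‖ ≤ δ / 2)
    {K : Set (EuclideanSpace ℝ (Fin n))} (hK : Metric.ball a δ ⊆ K)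
    (hb : Bornology.IsBounded (f '' (Metric.ball a δ ∩ K))) :
    2⁻¹ * Real.logb 2 (1 + Aᵀ * A).det - 2 * n ≤
      Real.logb 2 (coveringNumber (f '' (Metric.ball a δ ∩ K)) δ) := by
  obtain ⟨M, hMu, hM, hdet⟩ := exists_mul_transpose_eq A
  have hM0 : 0 < |M.det| := abs_pos.2 ((Matrix.isUnit_iff_isUnit_det M).1 hMu).ne_zero
  rw [← hdet]
  obtain ⟨F, hFN, hFc⟩ := exists_card_eq_coveringNumber hb hδ
  rw [← hFN]
  -- the `2δ`-balls of the enlarged cover contain a translate of the ellipsoid `M (B_{δ/2})`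
  have hsub : (fun w => -f a + w) ⁻¹' (toLpLin 2 2 M '' Metric.ball 0 (δ / 2)) ⊆
      ⋃ x ∈ F, Metric.ball x (2 * δ) := by
    rintro w ⟨u, hu, huw⟩
    rw [mem_ball_zero_iff] at hu
    obtain ⟨y, z, h1, h2⟩ := exists_add_eq_of_mul_transpose_eq hMu hM u
    have hy : ‖y‖ ≤ ‖u‖ := le_of_sq_le_sq (by nlinarith [sq_nonneg ‖z‖]) (norm_nonneg _)
    have hz : ‖z‖ ≤ ‖u‖ := le_of_sq_le_sq (by nlinarith [sq_nonneg ‖y‖]) (norm_nonneg _)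
    have hya : a + y ∈ Metric.ball a δ := by
      rw [Metric.mem_ball, dist_eq_norm, add_sub_cancel_left]; linarith
    have h3 := hFc ⟨a + y, ⟨hya, hK hya⟩, rfl⟩
    simp only [Set.mem_iUnion, Metric.mem_ball] at h3 ⊢
    obtain ⟨x, hx, hxy⟩ := h3
    refine ⟨x, hx, ?_⟩
    have h4 := h _ hya
    rw [add_sub_cancel_left] at h4
    have h5 : w - f (a + y) = z - (f (a + y) - f a - toLpLin 2 2 A y) := by
      have : -f a + w = toLpLin 2 2 A y + z := by rw [← h1]; exact huw.symm
      rw [← sub_eq_zero] at this ⊢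
      rw [← this]; abel
    have h6 : dist w (f (a + y)) ≤ δ := by
      rw [dist_eq_norm, h5]
      exact (norm_sub_le _ _).trans (by linarith)
    linarith [dist_triangle w (f (a + y)) x]
  have hv := volume_real_ball_one_pos (n := n)
  have hvol : |M.det| * volume.real (Metric.ball (0 : EuclideanSpace ℝ (Fin n)) (δ / 2)) ≤
      F.card * ((2 * δ) ^ n * volume.real (Metric.ball (0 : EuclideanSpace ℝ (Fin n)) 1)) := by
    calc _ = volume.real ((fun w => -f a + w) ⁻¹' (toLpLin 2 2 M '' Metric.ball 0 (δ / 2))) := by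
          rw [measureReal_def, measureReal_def, volume_affine_image_ball, ENNReal.toReal_mul,
            ENNReal.toReal_ofReal (abs_nonneg _)]
      _ ≤ volume.real (⋃ x ∈ F, Metric.ball x (2 * δ)) := by
          refine measureReal_mono hsub ?_
          exact ((measure_biUnion_finset_le _ _).trans_lt
            (ENNReal.sum_lt_top.2 fun x _ => measure_ball_lt_top)).ne
      _ ≤ ∑ x ∈ F, volume.real (Metric.ball x (2 * δ)) := measureReal_biUnion_finset_le _ _
      _ = _ := by
          rw [← nsmul_eq_mul, ← Finset.sum_const]
          exact Finset.sum_congr rfl fun x _ => volume_real_ball x (by positivity)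
  rw [volume_real_ball _ (by positivity)] at hvol
  have h4 : |M.det| ≤ F.card * 4 ^ n := by
    have e : (2 * δ) ^ n = 4 ^ n * (δ / 2) ^ n := by rw [← mul_pow]; ring
    rw [e] at hvol
    have h5 : 0 < (δ / 2) ^ n * volume.real (Metric.ball (0 : EuclideanSpace ℝ (Fin n)) 1) := by
      positivity
    refine le_of_mul_le_mul_right ?_ h5
    calc _ ≤ _ := hvol
      _ = _ := by ring
  have hF0 : (F.card : ℝ) ≠ 0 := by
    intro h0
    rw [h0, zero_mul] at h4
    linarith
  have h6 := Real.logb_le_logb_of_le one_lt_two hM0 h4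
  rw [Real.logb_mul hF0 (by positivity), logb_two_four_pow] at h6
  linarith

/-! ### Jacobians of iterates -/

theorem toLpLin_jacobian (f : EuclideanSpace ℝ (Fin n) → EuclideanSpace ℝ (Fin n))
    (x v : EuclideanSpace ℝ (Fin n)) : toLpLin 2 2 (jacobian f x) v = fderiv ℝ f x v := by
  have hv : v = ∑ j, v j • EuclideanSpace.single j (1 : ℝ) := by
    ext i
    simp [Pi.single_apply]
  conv_rhs => rw [hv]
  ext i
  simp [toLpLin_apply, jacobian, Matrix.mulVec, dotProduct, mul_comm]

theorem jacobian_comp {f g : EuclideanSpace ℝ (Fin n) → EuclideanSpace ℝ (Fin n)}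
    (hg : Differentiable ℝ g) (hf : Differentiable ℝ f) (x : EuclideanSpace ℝ (Fin n)) :
    jacobian (g ∘ f) x = jacobian g (f x) * jacobian f x := by
  apply (toLpLin 2 2).injective
  ext1 v
  rw [toLpLin_mul_same, LinearMap.comp_apply, toLpLin_jacobian, toLpLin_jacobian,
    toLpLin_jacobian, fderiv_comp x (hg _) (hf _)]
  rfl

theorem jacobian_id (x : EuclideanSpace ℝ (Fin n)) : jacobian id x = 1 := by
  apply (toLpLin 2 2).injective
  ext1 v
  rw [toLpLin_jacobian, fderiv_id]
  simp

theorem contDiff_iterate {φ : EuclideanSpace ℝ (Fin n) → EuclideanSpace ℝ (Fin n)}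
    (hφ : ContDiff ℝ 1 φ) (τ : ℕ) : ContDiff ℝ 1 φ^[τ] := by
  induction τ with
  | zero => exact contDiff_id
  | succ τ ih => rw [Function.iterate_succ]; exact ih.comp hφ

theorem jacobian_iterate_add {φ : EuclideanSpace ℝ (Fin n) → EuclideanSpace ℝ (Fin n)}
    (hφ : ContDiff ℝ 1 φ) (s t : ℕ) (x : EuclideanSpace ℝ (Fin n)) :
    jacobian φ^[s + t] x = jacobian φ^[s] (φ^[t] x) * jacobian φ^[t] x := by
  rw [Function.iterate_add]
  exact jacobian_comp ((contDiff_iterate hφ s).differentiable one_ne_zero)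
    ((contDiff_iterate hφ t).differentiable one_ne_zero) x

theorem continuous_jacobian {f : EuclideanSpace ℝ (Fin n) → EuclideanSpace ℝ (Fin n)}
    (hf : ContDiff ℝ 1 f) : Continuous (jacobian f) := by
  have := hf.continuous_fderiv one_ne_zero
  unfold jacobian
  refine continuous_pi fun i => continuous_pi fun j => ?_
  have h : Continuous fun x => fderiv ℝ f x (EuclideanSpace.single j 1) :=
    this.clm_apply continuous_const
  exact (EuclideanSpace.proj (𝕜 := ℝ) i).continuous.comp h

theorem isUnit_jacobian_iterate {φ : EuclideanSpace ℝ (Fin n) → EuclideanSpace ℝ (Fin n)}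
    (hφ : ContDiff ℝ 1 φ) {K : Set (EuclideanSpace ℝ (Fin n))} (hinv : Set.MapsTo φ K K)
    (hu : ∀ x ∈ K, IsUnit (jacobian φ x)) (τ : ℕ) {x : EuclideanSpace ℝ (Fin n)} (hx : x ∈ K) :
    IsUnit (jacobian φ^[τ] x) := by
  induction τ with
  | zero => rw [Function.iterate_zero, jacobian_id]; exact isUnit_one
  | succ τ ih =>
    rw [add_comm, jacobian_iterate_add hφ]
    exact (hu _ (hinv.iterate τ hx)).mul ih

/-- A `C¹` map is differentiable uniformly on a compact set. -/
theorem eventually_forall_norm_sub_le {f : EuclideanSpace ℝ (Fin n) → EuclideanSpace ℝ (Fin n)}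
    (hf : ContDiff ℝ 1 f) {K : Set (EuclideanSpace ℝ (Fin n))} (hK : IsCompact K) {c : ℝ}
    (hc : 0 < c) : ∀ᶠ δ in 𝓝[>] (0 : ℝ), ∀ a ∈ K, ∀ y ∈ Metric.ball a δ,
      ‖f y - f a - toLpLin 2 2 (jacobian f a) (y - a)‖ ≤ c * δ := by
  have h1 := hK.uniformContinuousAt_of_continuousAt (fderiv ℝ f)
    (fun a _ => (hf.continuous_fderiv one_ne_zero).continuousAt) (Metric.dist_mem_uniformity hc)
  obtain ⟨δ₀, hδ₀, h2⟩ := Metric.mem_uniformity_dist.1 h1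
  filter_upwards [Ioo_mem_nhdsGT hδ₀] with δ hδ a ha y hy
  rw [toLpLin_jacobian]
  have h3 : ∀ z ∈ Metric.ball a δ, ‖fderiv ℝ f z - fderiv ℝ f a‖ ≤ c := by
    intro z hz
    rw [Metric.mem_ball, dist_comm] at hz
    have h4 : dist (fderiv ℝ f a) (fderiv ℝ f z) < c := h2 (hz.trans hδ.2) ha
    rw [dist_comm, dist_eq_norm] at h4
    exact h4.le
  have h5 := (convex_ball a δ).norm_image_sub_le_of_norm_fderiv_le' (𝕜 := ℝ)
    (fun z _ => (hf.differentiable one_ne_zero) z) h3 (Metric.mem_ball_self hδ.1) hy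
  refine h5.trans ?_
  rw [Metric.mem_ball, dist_eq_norm] at hy
  gcongr

/-- `½ log₂ det (1 + Aᵀ A)` for the Jacobian `A` of `φ^τ` at `x`. Up to a constant that depends on
the dimension only, it is the sum of the positive parts of the logarithms of the singular values. -/
def logGrowth (φ : EuclideanSpace ℝ (Fin n) → EuclideanSpace ℝ (Fin n)) (τ : ℕ)
    (x : EuclideanSpace ℝ (Fin n)) : ℝ :=
  2⁻¹ * Real.logb 2 (1 + (jacobian φ^[τ] x)ᵀ * jacobian φ^[τ] x).det

theorem continuous_logGrowth {φ : EuclideanSpace ℝ (Fin n) → EuclideanSpace ℝ (Fin n)}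
    (hφ : ContDiff ℝ 1 φ) (τ : ℕ) : Continuous (logGrowth φ τ) := by
  have hj := continuous_jacobian (contDiff_iterate hφ τ)
  have hd : Continuous fun x => (1 + (jacobian φ^[τ] x)ᵀ * jacobian φ^[τ] x).det := by fun_prop
  have hl := hd.log fun x => (one_add_transpose_mul_self_posDef (jacobian φ^[τ] x)).det_pos.ne'
  exact (hl.div_const (Real.log 2)).const_mul 2⁻¹

/-! ### Covering numbers of images of small balls -/

theorem eventually_logCover_le {φ : EuclideanSpace ℝ (Fin n) → EuclideanSpace ℝ (Fin n)}
    (hφ : ContDiff ℝ 1 φ) {K : Set (EuclideanSpace ℝ (Fin n))} (hK : IsCompact K) (τ : ℕ) :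
    ∀ᶠ δ in 𝓝[>] (0 : ℝ), ∀ a ∈ K, logCover φ K τ a δ ≤ logGrowth φ τ a + 2 * n := by
  filter_upwards [eventually_forall_norm_sub_le (contDiff_iterate hφ τ) hK one_pos,
    self_mem_nhdsWithin] with δ h hδ a ha
  exact logb_coveringNumber_le hδ (fun y hy => by simpa using h a ha y hy) K

theorem eventually_le_logCover {φ : EuclideanSpace ℝ (Fin n) → EuclideanSpace ℝ (Fin n)}
    (hφ : ContDiff ℝ 1 φ) {K : Set (EuclideanSpace ℝ (Fin n))} (hK : IsCompact K) (τ : ℕ)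
    {a : EuclideanSpace ℝ (Fin n)} (ha : a ∈ interior K) :
    ∀ᶠ δ in 𝓝[>] (0 : ℝ), logGrowth φ τ a - 2 * n ≤ logCover φ K τ a δ := by
  obtain ⟨r, hr, hrK⟩ := Metric.mem_nhds_iff.1 (mem_interior_iff_mem_nhds.1 ha)
  filter_upwards [eventually_forall_norm_sub_le (contDiff_iterate hφ τ) (isCompact_singleton (x := a))
    (half_pos one_pos), Ioo_mem_nhdsGT hr] with δ h hδ
  refine le_logb_coveringNumber hδ.1 (fun y hy => ?_)
    ((Metric.ball_subset_ball hδ.2.le).trans hrK) ?_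
  · have := h a rfl y hy
    linarith
  · exact ((hK.image (contDiff_iterate hφ τ).continuous).isBounded).subset
      (Set.image_mono Set.inter_subset_right)

theorem logCover_nonneg (φ : EuclideanSpace ℝ (Fin n) → EuclideanSpace ℝ (Fin n))
    (K : Set (EuclideanSpace ℝ (Fin n))) (τ : ℕ) (a : EuclideanSpace ℝ (Fin n)) (δ : ℝ) :
    0 ≤ logCover φ K τ a δ := by
  rw [logCover]
  rcases Nat.eq_zero_or_pos (coveringNumber (φ^[τ] '' (Metric.ball a δ ∩ K)) δ) with h | h
  · simp [h]
  · exact Real.logb_nonneg one_lt_two (by exact_mod_cast h)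

theorem natCast_le_rpow_of_logb_le {N : ℕ} {c : ℝ} (h : Real.logb 2 N ≤ c) :
    (N : ℝ) ≤ 2 ^ c := by
  rcases Nat.eq_zero_or_pos N with h0 | h0
  · rw [h0, Nat.cast_zero]; positivity
  · exact (Real.logb_le_iff_le_rpow one_lt_two (by exact_mod_cast h0)).1 h

/-- Every `δ`-ball meets `K` in a set covered by `3ⁿ` balls of the same radius with centres in
`K`. -/
theorem exists_finset_cover_ball_inter (K : Set (EuclideanSpace ℝ (Fin n)))
    (y : EuclideanSpace ℝ (Fin n)) {δ : ℝ} (hδ : 0 < δ) :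
    ∃ F : Finset (EuclideanSpace ℝ (Fin n)), ↑F ⊆ K ∧
      Metric.ball y δ ∩ K ⊆ ⋃ x ∈ F, Metric.ball x δ ∧ (F.card : ℝ) ≤ 3 ^ n := by
  obtain ⟨F, h1, h2, h3⟩ := exists_finset_cover (S := Metric.ball y δ ∩ K)
    (T := Metric.ball y (3 * (δ / 2))) hδ (fun x hx => Metric.ball_subset_ball' (by
      have := Metric.mem_ball.1 hx.1; linarith)) measure_ball_lt_top.ne
  refine ⟨F, h1.trans Set.inter_subset_right, h2, ?_⟩
  have hv := volume_real_ball_one_pos (n := n)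
  rw [volume_real_ball _ (half_pos hδ), volume_real_ball _ (r := 3 * (δ / 2)) (by positivity),
    mul_pow, mul_assoc] at h3
  have h5 : 0 < (δ / 2) ^ n * volume.real (Metric.ball (0 : EuclideanSpace ℝ (Fin n)) 1) := by
    positivity
  exact le_of_mul_le_mul_right h3 h5

/-- Covers of the images under `φ^t` and `φ^s` combine to covers of the images under `φ^(s+t)`. The
term `log₂ 3ⁿ` pays for moving the centres of the intermediate cover into `K`. -/
theorem logCover_add_le {φ : EuclideanSpace ℝ (Fin n) → EuclideanSpace ℝ (Fin n)}
    (hφ : Continuous φ) {K : Set (EuclideanSpace ℝ (Fin n))} (hK : IsCompact K)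
    (hinv : Set.MapsTo φ K K) {s t : ℕ} {δ c₁ c₂ : ℝ} (hδ : 0 < δ)
    (hs : ∀ a ∈ K, logCover φ K s a δ ≤ c₁) (ht : ∀ a ∈ K, logCover φ K t a δ ≤ c₂)
    {a : EuclideanSpace ℝ (Fin n)} (ha : a ∈ K) :
    logCover φ K (s + t) a δ ≤ c₁ + c₂ + Real.logb 2 (3 ^ n) := by
  classical
  have hb : ∀ (τ : ℕ) (b : EuclideanSpace ℝ (Fin n)),
      Bornology.IsBounded (φ^[τ] '' (Metric.ball b δ ∩ K)) := fun τ b =>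
    ((hK.image (hφ.iterate τ)).isBounded).subset (Set.image_mono Set.inter_subset_right)
  obtain ⟨F, hFc, hF⟩ := exists_card_eq_coveringNumber (hb t a) hδ
  choose G hGK hG hGc using fun y => exists_finset_cover_ball_inter K y hδ
  choose J hJc hJ using fun b => exists_card_eq_coveringNumber (hb s b) hδ
  -- `F` covers the image under `φ^t`, `G y` recentres its ball about `y` in `K`, and `J b` covers the
  -- image under `φ^s` of the `δ`-ball about `b`
  have hcov : φ^[s + t] '' (Metric.ball a δ ∩ K) ⊆
      ⋃ x ∈ F.biUnion fun y => (G y).biUnion J, Metric.ball x δ := by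
    rintro _ ⟨x, hx, rfl⟩
    have h1 := hF ⟨x, hx, rfl⟩
    simp only [Set.mem_iUnion] at h1
    obtain ⟨y, hy, hxy⟩ := h1
    have h2 := hG y ⟨hxy, hinv.iterate t hx.2⟩
    simp only [Set.mem_iUnion] at h2
    obtain ⟨b, hb', hxb⟩ := h2
    have h3 := hJ b ⟨φ^[t] x, ⟨hxb, hinv.iterate t hx.2⟩, rfl⟩
    simp only [Set.mem_iUnion] at h3
    obtain ⟨z, hz, hxz⟩ := h3
    simp only [Set.mem_iUnion]
    refine ⟨z, ?_, by rwa [Function.iterate_add_apply]⟩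
    simp only [Finset.mem_biUnion]
    exact ⟨y, hy, b, hb', hz⟩
  have hle := coveringNumber_le_card hcov
  have hcard : ((F.biUnion fun y => (G y).biUnion J).card : ℝ) ≤
      2 ^ c₂ * (3 ^ n * (2 : ℝ) ^ c₁) := by
    have hFle : (F.card : ℝ) ≤ 2 ^ c₂ := by
      rw [hFc]; exact natCast_le_rpow_of_logb_le (ht a ha)
    calc ((F.biUnion fun y => (G y).biUnion J).card : ℝ)
        ≤ ∑ y ∈ F, (((G y).biUnion J).card : ℝ) := by exact_mod_cast Finset.card_biUnion_le
      _ ≤ ∑ _y ∈ F, (3 ^ n * (2 : ℝ) ^ c₁) := Finset.sum_le_sum fun y _ => by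
          calc (((G y).biUnion J).card : ℝ) ≤ ∑ b ∈ G y, ((J b).card : ℝ) := by
                exact_mod_cast Finset.card_biUnion_le
            _ ≤ ∑ _b ∈ G y, (2 : ℝ) ^ c₁ := Finset.sum_le_sum fun b hb' => by
                rw [hJc]; exact natCast_le_rpow_of_logb_le (hs b (hGK y hb'))
            _ = (G y).card * (2 : ℝ) ^ c₁ := by rw [Finset.sum_const, nsmul_eq_mul]
            _ ≤ _ := by gcongr; exact hGc y
      _ = F.card * (3 ^ n * (2 : ℝ) ^ c₁) := by rw [Finset.sum_const, nsmul_eq_mul]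
      _ ≤ _ := by gcongr
  have hfin : (coveringNumber (φ^[s + t] '' (Metric.ball a δ ∩ K)) δ : ℝ) ≤
      2 ^ c₂ * (3 ^ n * (2 : ℝ) ^ c₁) := le_trans (by exact_mod_cast hle) hcard
  rw [logCover]
  have hc1 := (logCover_nonneg φ K s a δ).trans (hs a ha)
  have hc2 := (logCover_nonneg φ K t a δ).trans (ht a ha)
  rcases Nat.eq_zero_or_pos (coveringNumber (φ^[s + t] '' (Metric.ball a δ ∩ K)) δ) with h | h
  · rw [h, Nat.cast_zero, Real.logb_zero]
    have : 0 ≤ Real.logb 2 (3 ^ n) :=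
      Real.logb_nonneg one_lt_two (one_le_pow₀ (by norm_num))
    positivity
  · have := Real.logb_le_logb_of_le one_lt_two (by exact_mod_cast h) hfin
    rw [Real.logb_mul (by positivity) (by positivity), Real.logb_mul (by positivity) (by positivity),
      Real.logb_rpow (by norm_num) (by norm_num), Real.logb_rpow (by norm_num) (by norm_num)] at this
    linarith

/-! ### Existence of the limit -/

/-- The upper limit in the definition of `rate`. -/
def limsupLogCover (φ : EuclideanSpace ℝ (Fin n) → EuclideanSpace ℝ (Fin n))
    (K : Set (EuclideanSpace ℝ (Fin n))) (τ : ℕ) : EReal :=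
  limsup (fun δ : ℝ => ⨆ a ∈ K, (logCover φ K τ a δ : EReal)) (𝓝[>] (0 : ℝ))

theorem limsupLogCover_le {φ : EuclideanSpace ℝ (Fin n) → EuclideanSpace ℝ (Fin n)}
    {K : Set (EuclideanSpace ℝ (Fin n))} {τ : ℕ} {c : ℝ}
    (h : ∀ᶠ δ in 𝓝[>] (0 : ℝ), ∀ a ∈ K, logCover φ K τ a δ ≤ c) :
    limsupLogCover φ K τ ≤ c := by
  refine limsup_le_of_le (h := ?_)
  filter_upwards [h] with δ hδ
  exact iSup₂_le fun a ha => EReal.coe_le_coe_iff.2 (hδ a ha)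

theorem le_limsupLogCover {φ : EuclideanSpace ℝ (Fin n) → EuclideanSpace ℝ (Fin n)}
    {K : Set (EuclideanSpace ℝ (Fin n))} {τ : ℕ} {c : ℝ} {a : EuclideanSpace ℝ (Fin n)}
    (ha : a ∈ K) (h : ∀ᶠ δ in 𝓝[>] (0 : ℝ), c ≤ logCover φ K τ a δ) :
    (c : EReal) ≤ limsupLogCover φ K τ := by
  refine le_limsup_of_frequently_le ?_
  refine (h.mono fun δ hδ => ?_).frequently
  exact (EReal.coe_le_coe_iff.2 hδ).trans (le_iSup₂_of_le a ha le_rfl)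

theorem eventually_logCover_le_of_lt {φ : EuclideanSpace ℝ (Fin n) → EuclideanSpace ℝ (Fin n)}
    {K : Set (EuclideanSpace ℝ (Fin n))} {τ : ℕ} {c : ℝ} (h : limsupLogCover φ K τ < c) :
    ∀ᶠ δ in 𝓝[>] (0 : ℝ), ∀ a ∈ K, logCover φ K τ a δ ≤ c := by
  filter_upwards [eventually_lt_of_limsup_lt h] with δ hδ a ha
  exact EReal.coe_le_coe_iff.1 ((le_iSup₂_of_le (f := fun a (_ : a ∈ K) =>
    (logCover φ K τ a δ : EReal)) a ha le_rfl).trans hδ.le)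

theorem coe_toReal_limsupLogCover {φ : EuclideanSpace ℝ (Fin n) → EuclideanSpace ℝ (Fin n)}
    (hφ : ContDiff ℝ 1 φ) {K : Set (EuclideanSpace ℝ (Fin n))} (hK : IsCompact K)
    (hne : K.Nonempty) (τ : ℕ) :
    ((limsupLogCover φ K τ).toReal : EReal) = limsupLogCover φ K τ := by
  obtain ⟨a, ha⟩ := hne
  have h0 : ((0 : ℝ) : EReal) ≤ limsupLogCover φ K τ :=
    le_limsupLogCover ha (Eventually.of_forall fun δ => logCover_nonneg φ K τ a δ)
  obtain ⟨C, hC⟩ := (hK.image (continuous_logGrowth hφ τ)).bddAbove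
  have h1 : limsupLogCover φ K τ ≤ ((C + 2 * n : ℝ) : EReal) := by
    refine limsupLogCover_le ?_
    filter_upwards [eventually_logCover_le hφ hK τ] with δ hδ a ha
    linarith [hδ a ha, hC (Set.mem_image_of_mem _ ha)]
  exact EReal.coe_toReal (ne_top_of_le_ne_top (EReal.coe_ne_top _) h1)
    (ne_bot_of_le_ne_bot (EReal.coe_ne_bot _) h0)

theorem toReal_limsupLogCover_add_le {φ : EuclideanSpace ℝ (Fin n) → EuclideanSpace ℝ (Fin n)}
    (hφ : ContDiff ℝ 1 φ) {K : Set (EuclideanSpace ℝ (Fin n))} (hK : IsCompact K)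
    (hne : K.Nonempty) (hinv : Set.MapsTo φ K K) (s t : ℕ) :
    (limsupLogCover φ K (s + t)).toReal ≤ (limsupLogCover φ K s).toReal +
      (limsupLogCover φ K t).toReal + Real.logb 2 (3 ^ n) := by
  refine le_of_forall_pos_le_add fun ε hε => ?_
  have key : ∀ τ, ∀ᶠ δ in 𝓝[>] (0 : ℝ), ∀ a ∈ K,
      logCover φ K τ a δ ≤ (limsupLogCover φ K τ).toReal + ε / 2 := fun τ => by
    refine eventually_logCover_le_of_lt ?_
    rw [← coe_toReal_limsupLogCover hφ hK hne τ, EReal.coe_lt_coe_iff, EReal.toReal_coe]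
    linarith
  rw [← EReal.coe_le_coe_iff, coe_toReal_limsupLogCover hφ hK hne]
  refine limsupLogCover_le ?_
  filter_upwards [key s, key t, self_mem_nhdsWithin] with δ h1 h2 hδ a ha
  linarith [logCover_add_le hφ.continuous hK hinv hδ h1 h2 ha]

/-- Fekete's lemma, applied to the upper limits of the covering numbers. -/
theorem exists_tendsto_limsupLogCover_div
    {φ : EuclideanSpace ℝ (Fin n) → EuclideanSpace ℝ (Fin n)}
    (hφ : ContDiff ℝ 1 φ) {K : Set (EuclideanSpace ℝ (Fin n))} (hK : IsCompact K)
    (hne : K.Nonempty) (hinv : Set.MapsTo φ K K) :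
    ∃ L : ℝ, Tendsto (fun τ : ℕ => (limsupLogCover φ K τ).toReal / τ) atTop (𝓝 L) ∧
      Hres φ K = L ∧ Tendsto (rate φ K) atTop (𝓝 (Hres φ K)) := by
  set c := Real.logb 2 (3 ^ n) with hc
  have hc0 : 0 ≤ c := Real.logb_nonneg one_lt_two (one_le_pow₀ (by norm_num))
  have h0 : ∀ τ, 0 ≤ (limsupLogCover φ K τ).toReal := fun τ => by
    obtain ⟨a, ha⟩ := hne
    refine EReal.toReal_nonneg ?_
    exact_mod_cast le_limsupLogCover (c := 0) ha
      (Eventually.of_forall fun δ => logCover_nonneg φ K τ a δ)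
  have hsub : Subadditive fun τ => (limsupLogCover φ K τ).toReal + c := fun s t => by
    have := toReal_limsupLogCover_add_le hφ hK hne hinv s t
    linarith
  have hbdd : BddBelow (Set.range fun τ : ℕ => ((limsupLogCover φ K τ).toReal + c) / τ) := by
    refine ⟨0, ?_⟩
    rintro _ ⟨τ, rfl⟩
    have := h0 τ
    positivity
  have hlim : Tendsto (fun τ : ℕ => (limsupLogCover φ K τ).toReal / τ) atTop (𝓝 hsub.lim) := by
    have := (hsub.tendsto_lim hbdd).sub (tendsto_const_div_atTop_nhds_zero_nat c)
    rw [sub_zero] at this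
    refine this.congr fun τ => ?_
    ring
  have hrate : Tendsto (rate φ K) atTop (𝓝 ((hsub.lim : ℝ) : EReal)) := by
    refine ((continuous_coe_real_ereal.tendsto _).comp hlim).congr fun τ => ?_
    have : rate φ K τ = (((τ : ℝ)⁻¹ : ℝ) : EReal) * limsupLogCover φ K τ := rfl
    rw [this, ← coe_toReal_limsupLogCover hφ hK hne, ← EReal.coe_mul, Function.comp_apply,
      div_eq_inv_mul]
  have hH : Hres φ K = hsub.lim := hrate.limUnder_eq
  exact ⟨_, hlim, hH, hH ▸ hrate⟩

/-! ### The upper bound -/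

/-- The pull-back `D(φ^τ)(x)ᵀ P(φ^τ(x)) D(φ^τ)(x)` of the metric `P` under `φ^τ`. -/
def pullback (φ : EuclideanSpace ℝ (Fin n) → EuclideanSpace ℝ (Fin n))
    (P : EuclideanSpace ℝ (Fin n) → Matrix (Fin n) (Fin n) ℝ) (τ : ℕ)
    (x : EuclideanSpace ℝ (Fin n)) : Matrix (Fin n) (Fin n) ℝ :=
  (jacobian φ^[τ] x)ᵀ * P (φ^[τ] x) * jacobian φ^[τ] x

section Metric

variable {φ : EuclideanSpace ℝ (Fin n) → EuclideanSpace ℝ (Fin n)}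
  {K : Set (EuclideanSpace ℝ (Fin n))}
  {P : EuclideanSpace ℝ (Fin n) → Matrix (Fin n) (Fin n) ℝ}

theorem sigma_eq_orderDist_pullback (x : EuclideanSpace ℝ (Fin n)) :
    sigma φ P x = orderDist (P x) (pullback φ P 1 x) := by
  rw [sigma_eq_orderDist, pullback, Function.iterate_one]

theorem continuousOn_pullback (hφ : ContDiff ℝ 1 φ) (hinv : Set.MapsTo φ K K)
    (hP : IsMetricOn K P) (τ : ℕ) : ContinuousOn (pullback φ P τ) K := by
  have hj := continuous_jacobian (contDiff_iterate hφ τ)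
  have hc : ContinuousOn (fun x => P (φ^[τ] x)) K :=
    hP.continuousOn.comp (contDiff_iterate hφ τ).continuous.continuousOn (hinv.iterate τ)
  exact (hj.matrix_transpose.continuousOn.mul hc).mul hj.continuousOn

theorem pullback_posSemidef (hinv : Set.MapsTo φ K K) (hP : IsMetricOn K P) (τ : ℕ)
    {x : EuclideanSpace ℝ (Fin n)} (hx : x ∈ K) : (pullback φ P τ x).PosSemidef :=
  transpose_conj_posSemidef (hP.posDef _ (hinv.iterate τ hx)).posSemidef _

theorem pullback_pullback (hφ : ContDiff ℝ 1 φ) (s t : ℕ) (x : EuclideanSpace ℝ (Fin n)) :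
    pullback φ (pullback φ P s) t x = pullback φ P (s + t) x := by
  simp only [pullback, jacobian_iterate_add hφ s t, Function.iterate_add_apply, transpose_mul,
    Matrix.mul_assoc]

theorem continuousOn_orderDist {F G : EuclideanSpace ℝ (Fin n) → Matrix (Fin n) (Fin n) ℝ}
    (hF : IsMetricOn K F) (hG : ContinuousOn G K) (hGp : ∀ x ∈ K, (G x).PosSemidef) :
    ContinuousOn (fun x => orderDist (F x) (G x)) K := fun x hx =>
  tendsto_orderDist (hF.continuousOn x hx) (hG x hx) (hF.posDef x hx) (hGp x hx)
    (eventually_mem_nhdsWithin.mono fun y hy => hF.posDef y hy)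
    (eventually_mem_nhdsWithin.mono fun y hy => hGp y hy)

theorem continuousOn_sigma (hφ : ContDiff ℝ 1 φ) (hinv : Set.MapsTo φ K K)
    (hP : IsMetricOn K P) : ContinuousOn (sigma φ P) K :=
  (continuousOn_orderDist hP (continuousOn_pullback hφ hinv hP 1)
    fun _ hx => pullback_posSemidef hinv hP 1 hx).congr
    fun x _ => sigma_eq_orderDist_pullback x

theorem exists_isGreatest_sigma (hφ : ContDiff ℝ 1 φ) (hK : IsCompact K) (hne : K.Nonempty)
    (hinv : Set.MapsTo φ K K) (hP : IsMetricOn K P) : ∃ m : ℝ, IsGreatest (sigma φ P '' K) m :=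
  (hK.image_of_continuousOn (continuousOn_sigma hφ hinv hP)).exists_isGreatest (hne.image _)

theorem orderDist_self_le (M : Matrix (Fin n) (Fin n) ℝ) (hM : M.PosDef) : orderDist M M ≤ 0 := by
  simpa using orderDist_le hM hM.posSemidef le_rfl le_rfl

theorem orderDist_pullback_le (hφ : ContDiff ℝ 1 φ) (hinv : Set.MapsTo φ K K)
    (hP : IsMetricOn K P) {m : ℝ} (hm : ∀ x ∈ K, sigma φ P x ≤ m) (τ : ℕ)
    {x : EuclideanSpace ℝ (Fin n)} (hx : x ∈ K) : orderDist (P x) (pullback φ P τ x) ≤ τ * m := by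
  induction τ with
  | zero =>
    have : pullback φ P 0 x = P x := by simp [pullback, jacobian_id]
    rw [this, Nat.cast_zero, zero_mul]
    exact orderDist_self_le _ (hP.posDef x hx)
  | succ τ ih =>
    have hy := hinv.iterate τ hx
    have h := orderDist_mul_le (hP.posDef x hx) (hP.posDef _ hy) (hP.posDef _ (hinv hy))
      (jacobian φ^[τ] x) (jacobian φ (φ^[τ] x))
    have h1 := hm _ hy
    rw [sigma_eq_orderDist] at h1
    have e : pullback φ P (τ + 1) x = (jacobian φ (φ^[τ] x) * jacobian φ^[τ] x)ᵀ *
        P (φ (φ^[τ] x)) * (jacobian φ (φ^[τ] x) * jacobian φ^[τ] x) := by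
      rw [pullback, add_comm τ 1, jacobian_iterate_add hφ, Function.iterate_add_apply,
        Function.iterate_one]
    rw [e]
    have h2 : orderDist (P x) ((jacobian φ^[τ] x)ᵀ * P (φ^[τ] x) * jacobian φ^[τ] x) ≤ τ * m := ih
    push_cast
    linarith

theorem isMetricOn_one (K : Set (EuclideanSpace ℝ (Fin n))) :
    IsMetricOn K fun _ => (1 : Matrix (Fin n) (Fin n) ℝ) :=
  ⟨continuousOn_const, fun _ _ => Matrix.PosDef.one⟩

/-- A change of metric on the compact set `K` alters the growth of the iterates by a bounded
amount only. -/
theorem exists_logGrowth_le (hφ : ContDiff ℝ 1 φ) (hK : IsCompact K) (hinv : Set.MapsTo φ K K)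
    (hP : IsMetricOn K P) {m : ℝ} (hm : ∀ x ∈ K, sigma φ P x ≤ m) :
    ∃ C : ℝ, ∀ τ : ℕ, ∀ x ∈ K, logGrowth φ τ x ≤ τ * m + C := by
  obtain ⟨c₁, h₁⟩ := (hK.image_of_continuousOn (continuousOn_orderDist (isMetricOn_one K)
    hP.continuousOn fun x hx => (hP.posDef x hx).posSemidef)).bddAbove
  obtain ⟨c₂, h₂⟩ := (hK.image_of_continuousOn (continuousOn_orderDist hP
    continuousOn_const fun _ _ => Matrix.PosSemidef.one)).bddAbove
  refine ⟨c₁ + c₂ + n / 2, fun τ x hx => ?_⟩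
  have hy := hinv.iterate τ hx
  have k0 := half_logb_det_le (jacobian φ^[τ] x)
  have k1 := orderDist_mul_le Matrix.PosDef.one (hP.posDef x hx) Matrix.PosDef.one 1
    (jacobian φ^[τ] x)
  have k2 := orderDist_mul_le (hP.posDef x hx) (hP.posDef _ hy) Matrix.PosDef.one
    (jacobian φ^[τ] x) 1
  simp only [transpose_one, Matrix.mul_one, Matrix.one_mul] at k1 k2
  have k3 := h₁ (Set.mem_image_of_mem _ hx)
  have k4 := h₂ (Set.mem_image_of_mem _ hy)
  have k5 : orderDist (P x) ((jacobian φ^[τ] x)ᵀ * P (φ^[τ] x) * jacobian φ^[τ] x) ≤ τ * m :=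
    orderDist_pullback_le hφ hinv hP hm τ hx
  rw [logGrowth]
  linarith

theorem Hres_le (hφ : ContDiff ℝ 1 φ) (hK : IsCompact K) (hne : K.Nonempty)
    (hinv : Set.MapsTo φ K K) (hP : IsMetricOn K P) {m : ℝ} (hm : ∀ x ∈ K, sigma φ P x ≤ m) :
    Hres φ K ≤ m := by
  obtain ⟨L, hL, hH, -⟩ := exists_tendsto_limsupLogCover_div hφ hK hne hinv
  obtain ⟨C, hC⟩ := exists_logGrowth_le hφ hK hinv hP hm
  rw [hH, EReal.coe_le_coe_iff]
  have hlim : Tendsto (fun τ : ℕ => m + (C + 2 * n) / τ) atTop (𝓝 m) := by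
    simpa using tendsto_const_nhds.add (tendsto_const_div_atTop_nhds_zero_nat (C + 2 * n))
  refine le_of_tendsto_of_tendsto hL hlim ?_
  filter_upwards [eventually_gt_atTop 0] with τ hτ
  have h1 : (limsupLogCover φ K τ).toReal ≤ τ * m + C + 2 * n := by
    rw [← EReal.coe_le_coe_iff, coe_toReal_limsupLogCover hφ hK hne]
    refine limsupLogCover_le ?_
    filter_upwards [eventually_logCover_le hφ hK τ] with δ hδ a ha
    linarith [hδ a ha, hC τ a ha]
  have hτ' : (0 : ℝ) < τ := by exact_mod_cast hτ
  rw [div_le_iff₀ hτ', add_mul, div_mul_cancel₀ _ hτ'.ne']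
  linarith

/-! ### Construction of an almost optimal metric -/

/-- The lower bound for the covering numbers at interior points extends by continuity to the closure
of the interior. -/
theorem logGrowth_le_toReal (hφ : ContDiff ℝ 1 φ) (hK : IsCompact K) (hne : K.Nonempty)
    (hcl : K = closure (interior K)) (τ : ℕ) {x : EuclideanSpace ℝ (Fin n)} (hx : x ∈ K) :
    logGrowth φ τ x ≤ (limsupLogCover φ K τ).toReal + 2 * n := by
  have hsub : closure (interior K) ⊆
      {x | logGrowth φ τ x ≤ (limsupLogCover φ K τ).toReal + 2 * n} := by
    refine closure_minimal (fun a ha => ?_)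
      (isClosed_le (continuous_logGrowth hφ τ) continuous_const)
    have h := le_limsupLogCover (interior_subset ha) (eventually_le_logCover hφ hK τ ha)
    rw [← coe_toReal_limsupLogCover hφ hK hne, EReal.coe_le_coe_iff] at h
    change logGrowth φ τ a ≤ _
    linarith
  exact hsub (hcl ▸ hx)

theorem pullback_posDef (hφ : ContDiff ℝ 1 φ) (hinv : Set.MapsTo φ K K)
    (hu : ∀ x ∈ K, IsUnit (jacobian φ x)) (hP : IsMetricOn K P) (τ : ℕ)
    {x : EuclideanSpace ℝ (Fin n)} (hx : x ∈ K) : (pullback φ P τ x).PosDef :=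
  transpose_conj_posDef (hP.posDef _ (hinv.iterate τ hx))
    (isUnit_jacobian_iterate hφ hinv hu τ hx)

theorem isMetricOn_geomMean {Q : EuclideanSpace ℝ (Fin n) → Matrix (Fin n) (Fin n) ℝ}
    (hP : IsMetricOn K P) (hQ : IsMetricOn K Q) :
    IsMetricOn K fun x => geomMean (P x) (Q x) where
  continuousOn x hx := tendsto_geomMean (hP.continuousOn x hx) (hQ.continuousOn x hx)
    (hP.posDef x hx) (hQ.posDef x hx)
    (eventually_mem_nhdsWithin.mono fun y hy => hP.posDef y hy)
    (eventually_mem_nhdsWithin.mono fun y hy => hQ.posDef y hy)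
  posDef x hx := geomMean_posDef (hP.posDef x hx) (hQ.posDef x hx)

/-- If `P` grows by at most `2r` along `φ^(2τ)`, then the midpoint of `P` and its pull-back under
`φ^τ` grows by at most `r` along `φ^τ`: both this midpoint and its pull-back are midpoints with the
common endpoint `pullback φ P τ`. -/
theorem exists_isMetricOn_halving (hφ : ContDiff ℝ 1 φ) (hinv : Set.MapsTo φ K K)
    (hu : ∀ x ∈ K, IsUnit (jacobian φ x)) (hP : IsMetricOn K P) {τ : ℕ} {r : ℝ}
    (h : ∀ x ∈ K, orderDist (P x) (pullback φ P (τ + τ) x) ≤ 2 * r) :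
    ∃ Q, IsMetricOn K Q ∧ ∀ x ∈ K, orderDist (Q x) (pullback φ Q τ x) ≤ r := by
  have hpull : IsMetricOn K (pullback φ P τ) :=
    ⟨continuousOn_pullback hφ hinv hP τ, fun x hx => pullback_posDef hφ hinv hu hP τ hx⟩
  refine ⟨fun x => geomMean (P x) (pullback φ P τ x), isMetricOn_geomMean hP hpull,
    fun x hx => ?_⟩
  have hy := hinv.iterate τ hx
  have hPP := pullback_posDef hφ hinv hu hP (τ + τ) hx
  have e : pullback φ (fun x => geomMean (P x) (pullback φ P τ x)) τ x =
      geomMean (pullback φ P τ x) (pullback φ P (τ + τ) x) := by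
    rw [← pullback_pullback hφ τ τ]
    exact transpose_mul_geomMean_mul (hP.posDef _ hy) (hpull.posDef _ hy)
      (isUnit_jacobian_iterate hφ hinv hu τ hx)
  simp only [e]
  rw [geomMean_comm (hP.posDef x hx) (hpull.posDef x hx)]
  linarith [orderDist_geomMean_le (hpull.posDef x hx) (hP.posDef x hx) hPP, h x hx]

theorem exists_isMetricOn_sigma_le (hφ : ContDiff ℝ 1 φ) (hinv : Set.MapsTo φ K K)
    (hu : ∀ x ∈ K, IsUnit (jacobian φ x)) (k : ℕ) {r : ℝ} (hP : IsMetricOn K P)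
    (h : ∀ x ∈ K, orderDist (P x) (pullback φ P (2 ^ k) x) ≤ 2 ^ k * r) :
    ∃ Q, IsMetricOn K Q ∧ ∀ x ∈ K, sigma φ Q x ≤ r := by
  induction k generalizing P with
  | zero =>
    refine ⟨P, hP, fun x hx => ?_⟩
    rw [sigma_eq_orderDist_pullback]
    simpa using h x hx
  | succ k ih =>
    obtain ⟨Q, hQ, hQr⟩ := exists_isMetricOn_halving hφ hinv hu hP (τ := 2 ^ k) (r := 2 ^ k * r)
      fun x hx => by
        have := h x hx
        rw [pow_succ, mul_two] at this
        rw [pow_succ] at this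
        linarith
    exact ih hQ hQr

theorem exists_isMetricOn_sub_le_Hres (hφ : ContDiff ℝ 1 φ) (hK : IsCompact K)
    (hne : K.Nonempty) (hinv : Set.MapsTo φ K K) (hcl : K = closure (interior K))
    (hu : ∀ x ∈ K, IsUnit (jacobian φ x)) {ε : ℝ} (hε : 0 < ε) :
    ∃ P, IsMetricOn K P ∧ ∃ m : ℝ, IsGreatest (sigma φ P '' K) m ∧
      ((m - ε : ℝ) : EReal) ≤ Hres φ K := by
  obtain ⟨L, hL, hH, -⟩ := exists_tendsto_limsupLogCover_div hφ hK hne hinv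
  -- a time `2 ^ k` at which the growth of the iterates is close to its limit
  have hlim : Tendsto (fun τ : ℕ => ((limsupLogCover φ K τ).toReal + 2 * n) / τ) atTop (𝓝 L) := by
    have := hL.add (tendsto_const_div_atTop_nhds_zero_nat (2 * n : ℝ))
    rw [add_zero] at this
    exact this.congr fun τ => (add_div _ _ _).symm
  have hpow : Tendsto (fun k : ℕ => 2 ^ k) atTop atTop :=
    tendsto_pow_atTop_atTop_of_one_lt one_lt_two
  obtain ⟨k, hk⟩ := ((hlim.comp hpow).eventually_lt_const (by linarith : L < L + ε)).exists
  have hk' : (limsupLogCover φ K (2 ^ k)).toReal + 2 * n ≤ 2 ^ k * (L + ε) := by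
    have h2 : (0 : ℝ) < 2 ^ k := by positivity
    simp only [Function.comp_apply, Nat.cast_pow, Nat.cast_ofNat] at hk
    rw [div_lt_iff₀ h2] at hk
    linarith
  obtain ⟨Q, hQ, hQr⟩ := exists_isMetricOn_sigma_le hφ hinv hu k (r := L + ε) (isMetricOn_one K)
    fun x hx => by
      have h1 := orderDist_one_le (jacobian φ^[2 ^ k] x)
      have h2 := logGrowth_le_toReal hφ hK hne hcl (2 ^ k) hx
      rw [logGrowth] at h2
      rw [pullback, Matrix.mul_one]
      linarith
  obtain ⟨m, hm⟩ := exists_isGreatest_sigma hφ hK hne hinv hQ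
  refine ⟨Q, hQ, m, hm, ?_⟩
  obtain ⟨x, hx, rfl⟩ := hm.1
  rw [hH, EReal.coe_le_coe_iff]
  linarith [hQr x hx]

end Metric

end RestorationEntropy

end

theorem theorem1 {n : ℕ}
    (φ : EuclideanSpace ℝ (Fin n) → EuclideanSpace ℝ (Fin n)) (hφ : ContDiff ℝ 1 φ)
    (K : Set (EuclideanSpace ℝ (Fin n))) (hK : IsCompact K) (hne : K.Nonempty)
    (hinv : Set.MapsTo φ K K) :
    -- the limit that defines the restoration entropy exists
    Tendsto (RestorationEntropy.rate φ K) atTop (𝓝 (RestorationEntropy.Hres φ K)) ∧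
    -- (i)
    (∀ P : EuclideanSpace ℝ (Fin n) → Matrix (Fin n) (Fin n) ℝ,
      RestorationEntropy.IsMetricOn K P →
        ∃ m : ℝ, IsGreatest (RestorationEntropy.sigma φ P '' K) m ∧
          RestorationEntropy.Hres φ K ≤ (m : EReal)) ∧
    -- (ii), and the resulting formula for the restoration entropy
    (K = closure (interior K) →
      (∀ x ∈ K, IsUnit (RestorationEntropy.jacobian φ x)) →
        (∀ ε : ℝ, 0 < ε →
          ∃ P : EuclideanSpace ℝ (Fin n) → Matrix (Fin n) (Fin n) ℝ,
            RestorationEntropy.IsMetricOn K P ∧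
            ∃ m : ℝ, IsGreatest (RestorationEntropy.sigma φ P '' K) m ∧
              ((m - ε : ℝ) : EReal) ≤ RestorationEntropy.Hres φ K) ∧
        IsGLB {h : EReal | ∃ P : EuclideanSpace ℝ (Fin n) → Matrix (Fin n) (Fin n) ℝ,
            RestorationEntropy.IsMetricOn K P ∧
            ∃ m : ℝ, IsGreatest (RestorationEntropy.sigma φ P '' K) m ∧ h = (m : EReal)}
          (RestorationEntropy.Hres φ K)) := by
  obtain ⟨L, -, hH, hrate⟩ :=
    RestorationEntropy.exists_tendsto_limsupLogCover_div hφ hK hne hinv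
  have upper : ∀ P, RestorationEntropy.IsMetricOn K P → ∀ m : ℝ,
      IsGreatest (RestorationEntropy.sigma φ P '' K) m → RestorationEntropy.Hres φ K ≤ m :=
    fun P hP m hm => RestorationEntropy.Hres_le hφ hK hne hinv hP
      fun x hx => hm.2 (Set.mem_image_of_mem _ hx)
  refine ⟨hrate, fun P hP => ?_, fun hcl hu => ⟨fun ε hε => ?_, ?_, fun b hb => ?_⟩⟩
  · obtain ⟨m, hm⟩ := RestorationEntropy.exists_isGreatest_sigma hφ hK hne hinv hP
    exact ⟨m, hm, upper P hP m hm⟩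
  · exact RestorationEntropy.exists_isMetricOn_sub_le_Hres hφ hK hne hinv hcl hu hε
  · rintro _ ⟨P, hP, m, hm, rfl⟩
    exact upper P hP m hm
  · rw [hH]
    refine EReal.le_of_forall_lt_iff_le.1 fun z hz => ?_
    have hε : 0 < z - L := sub_pos.2 (EReal.coe_lt_coe_iff.1 hz)
    obtain ⟨P, hP, m, hm, hle⟩ :=
      RestorationEntropy.exists_isMetricOn_sub_le_Hres hφ hK hne hinv hcl hu hε
    rw [hH, EReal.coe_le_coe_iff] at hle
    refine (hb ⟨P, hP, m, hm, rfl⟩).trans (EReal.coe_le_coe_iff.2 ?_)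
    linarith
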